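/- **Setting.** Let $\Gamma=\mathbb{Z}^d$ carry a translation invariant metric $(x,y)\mapsto|x-y|$ which is equivalent to the Euclidean one, let $\mathfrak{A}$ be the quasilocal $C^*$-algebra of a quantum spin system with an $\ell$-dimensional spin at each site (the norm completion of $\bigcup_\Lambda\mathfrak{A}(\Lambda)$, $\mathfrak{A}(\Lambda)=\bigotimes_{x\in\Lambda}M_\ell(\mathbb{C})$, $\Lambda\subset\Gamma$ finite), and let $\tau_x$, $x\in\Gamma$, be the translation automorphisms. Let $F:[0,\infty)\to(0,\infty)$ be non-increasing with $\sum_{x\in\Gamma} F(|x|)<\infty$ and $\sup_{x,y}\sum_z F(|z-x|)F(|y-z|)/F(|y-x|)<\infty$, and let $\Phi$ be a translation invariant interaction, that is, self-adjoint elements $\Phi(X)\in\mathfrak{A}(X)$ for finite $X\subset\Gamma$ with $\Phi(X+x)=\tau_x(\Phi(X))$, such that for some $\lambda>0$ $$\sup_{x\in\Gamma}\sum_{X\ni x,0}\frac{\|\Phi(X)\|}{e^{-\lambda|x|}F(|x|)}<\infty .$$ Let $\tau_t(A)=\lim_{\Lambda\nearrow\Gamma}e^{itH_\Lambda}Ae^{-itH_\Lambda}$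 with $H_\Lambda=\sum_{X\subset\Lambda}\Phi(X)$ be the dynamics of $\Phi$, and $\tau_{(t,x)}=\tau_t\circ\tau_x$. Let $\omega$ be a translation invariant ground state: a state on $\mathfrak{A}$, invariant under all $\tau_t$ and $\tau_x$, such that in its GNS representation $(\pi,\mathcal{H},\Omega)$ the unitary representation $U$ of $\mathbb{R}\times\Gamma$ with $U(t,x)\pi(A)U(t,x)^*=\pi(\tau_{(t,x)}(A))$ and $U(t,x)\Omega=\Omega$ has a positive generator $H$ of time translations, $U(t,0)=e^{itH}$. Let $\widehat\Gamma=(\mathbb{R}/2\pi\mathbb{Z})^d$, let $P$ be the spectral measure on $\mathbb{R}\times\widehat\Gamma$ with $U(t,x)=\int e^{iEt-ipx}\,dP(E,p)$, and let $\mathrm{Sp}\,U$ be the support of $P$. For $f\in L^1(\mathbb{R}\times\Gamma)$ put $$\widehat f(E,p)=(2\pi)^{-\frac{d+1}{2}}\sum_{x}\int dt\,e^{iEt-ipx}f(t,x),\qquad \tau_f(A)=(2\pi)^{-\frac{d+1}{2}}\sum_x\int dt\,f(t,x)\,\tau_{(t,x)}(A).$$ The Arveson spectrum $\mathrm{Sp}_A\tau$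 of $A\in\mathfrak{A}$ is the smallest closed subset of $\mathbb{R}\times\widehat\Gamma$ such that $\tau_f(A)=0$ for every $f\in L^1(\mathbb{R}\times\Gamma)$ for which $\mathrm{supp}\,\widehat f$ is disjoint from it. $A$ is almost local if there are $A_r\in\mathfrak{A}(\{x:|x|\le r\})$, $r\geq 0$, with $\|A-A_r\|=O(r^{-n})$ as $r\to\infty$ for all $n\in\mathbb{N}$. **Theorem 3.6.** Let $\Delta$ be a compact subset of $\mathrm{Sp}\,U$ and let $A\in\mathfrak{A}$ be such that $\mathrm{Sp}_A\tau$ is a compact subset of $(-\infty,0)\times\widehat\Gamma$. Then there is a constant $C$ such that for every finite $\Lambda\subset\Gamma$ $$\Big\|P(\Delta)\sum_{x\in\Lambda}\pi(\tau_x(A^*A))P(\Delta)\Big\|\le C\sum_{x\in\Lambda-\Lambda}\|[A^*,\tau_x(A)]\|,\qquad \Lambda-\Lambda=\{x_1-x_2 : x_1,x_2\in\Lambda\}.$$ If in addition $A$ is almost local, then $P(\Delta)\sum_{x\in\Gamma}\pi(\tau_x(A^*A))P(\Delta)$, understood as the strong limit of the sums over finite subsets of $\Gamma$, is a bounded operator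 on $\mathcal{H}$. -/

import Mathlib

open scoped ENNReal InnerProductSpace Pointwise ComplexOrder Topology
open Filter MeasureTheory

namespace SpinSystem

noncomputable section

/-! ## The lattice, the spin configurations and the quasilocal algebra -/

/-- The lattice `Γ = ℤ^d`. -/
abbrev SpinLattice (d : ℕ) : Type := Fin d → ℤ

/-- Classical configurations: an element of `{0, …, ℓ - 1}` at each site. -/
abbrev Config (d ℓ : ℕ) : Type := SpinLattice d → Fin ℓ

/-- The Hilbert space `ℓ²(Config)`, on which all the local algebras act faithfully
(a matrix in `⨂_{x ∈ Λ} M_ℓ(ℂ)` acts on the spins in `Λ` and as the identity on the others). -/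
abbrev RefSpace (d ℓ : ℕ) : Type := lp (fun _ : Config d ℓ => ℂ) 2

/-- The bounded operators on the reference Hilbert space. -/
abbrev RefOp (d ℓ : ℕ) : Type := RefSpace d ℓ →L[ℂ] RefSpace d ℓ

theorem sum_pullback_le {ι : Type*} (f : ι → ι) (S : Set ι) (hf : Set.InjOn f S)
    (ψ : lp (fun _ : ι => ℂ) 2) (s : Finset ι) :
    ∑ i ∈ s, ‖S.indicator (fun j => ψ (f j)) i‖ ^ (2 : ℝ≥0∞).toReal
      ≤ ‖ψ‖ ^ (2 : ℝ≥0∞).toReal := by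
  classical
  have h2 : (0 : ℝ) < (2 : ℝ≥0∞).toReal := by norm_num
  have h1 : ∑ i ∈ s, ‖S.indicator (fun j => ψ (f j)) i‖ ^ (2 : ℝ≥0∞).toReal
      = ∑ i ∈ s with i ∈ S, ‖ψ (f i)‖ ^ (2 : ℝ≥0∞).toReal := by
    rw [Finset.sum_filter]
    refine Finset.sum_congr rfl fun i _ => ?_
    by_cases hi : i ∈ S
    · simp [hi]
    · simp [hi]
  have hinj : Set.InjOn f (s.filter (· ∈ S) : Finset ι) := by
    intro a ha b hb hab
    simp only [Finset.coe_filter, Set.mem_ofPred_eq] at ha hb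
    exact hf ha.2 hb.2 hab
  rw [h1, ← Finset.sum_image (f := fun i => ‖ψ i‖ ^ (2 : ℝ≥0∞).toReal) hinj]
  exact lp.sum_rpow_le_norm_rpow h2 ψ _

/-- For `f` injective on `S`, the contraction `ψ ↦ 1_S · (ψ ∘ f)` of `ℓ²`. -/
def pullback {ι : Type*} (f : ι → ι) (S : Set ι) (hf : Set.InjOn f S) :
    lp (fun _ : ι => ℂ) 2 →L[ℂ] lp (fun _ : ι => ℂ) 2 :=
  LinearMap.mkContinuous
    { toFun := fun ψ => ⟨S.indicator (fun j => ψ (f j)), memℓp_gen' (sum_pullback_le f S hf ψ)⟩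
      map_add' := fun ψ φ => by
        ext i
        change S.indicator (fun j => ψ (f j) + φ (f j)) i =
          S.indicator (fun j => ψ (f j)) i + S.indicator (fun j => φ (f j)) i
        by_cases hi : i ∈ S <;> simp [hi]
      map_smul' := fun c ψ => by
        ext i
        by_cases hi : i ∈ S <;> simp [hi] }
    1 (fun ψ => by
      rw [one_mul]
      exact lp.norm_le_of_forall_sum_le (by norm_num) (norm_nonneg _) (sum_pullback_le f S hf ψ))

theorem pullback_apply {ι : Type*} (f : ι → ι) (S : Set ι) (hf : Set.InjOn f S)
    (ψ : lp (fun _ : ι => ℂ) 2) (i : ι) :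
    (pullback f S hf ψ) i = S.indicator (fun j => ψ (f j)) i := rfl

variable {d ℓ : ℕ}

/-- The restriction of a configuration to the region `Λ`. -/
def restrictTo (Λ : Finset (SpinLattice d)) (s : Config d ℓ) : Λ → Fin ℓ := fun x => s x

/-- The configuration `s` with its spins in `Λ` replaced by `v`. -/
def overwrite (Λ : Finset (SpinLattice d)) (v : Λ → Fin ℓ) (s : Config d ℓ) : Config d ℓ :=
  fun x => if h : x ∈ Λ then v ⟨x, h⟩ else s x

theorem restrictTo_overwrite (Λ : Finset (SpinLattice d)) (v : Λ → Fin ℓ) (s : Config d ℓ) :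
    restrictTo Λ (overwrite Λ v s) = v := by
  funext x
  simp [restrictTo, overwrite]

theorem overwrite_overwrite (Λ : Finset (SpinLattice d)) (u v : Λ → Fin ℓ) (s : Config d ℓ) :
    overwrite Λ u (overwrite Λ v s) = overwrite Λ u s := by
  funext x
  by_cases h : x ∈ Λ <;> simp [overwrite, h]

theorem overwrite_restrictTo (Λ : Finset (SpinLattice d)) (s : Config d ℓ) :
    overwrite Λ (restrictTo Λ s) s = s := by
  funext x
  by_cases h : x ∈ Λ <;> simp [overwrite, restrictTo, h]

theorem injOn_overwrite (Λ : Finset (SpinLattice d)) (u v : Λ → Fin ℓ) :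
    Set.InjOn (overwrite Λ v) {s : Config d ℓ | restrictTo Λ s = u} := by
  intro s hs t ht h
  have h' := congrArg (overwrite Λ u) h
  simp only [overwrite_overwrite] at h'
  rw [Set.mem_ofPred_eq] at hs ht
  have e1 := overwrite_restrictTo Λ s
  have e2 := overwrite_restrictTo Λ t
  rw [hs] at e1
  rw [ht] at e2
  rw [← e1, ← e2, h']

/-- The matrix unit `|u⟩⟨v|` of the spins in `Λ`, tensored with the identity outside `Λ`:
`(E ψ)(s) = ψ(s with v in Λ)` if `s` restricts to `u` on `Λ`, and `0` otherwise. -/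
def matrixUnit (Λ : Finset (SpinLattice d)) (u v : Λ → Fin ℓ) : RefOp d ℓ :=
  pullback (overwrite Λ v) {s | restrictTo Λ s = u} (injOn_overwrite Λ u v)

theorem matrixUnit_apply (Λ : Finset (SpinLattice d)) (u v : Λ → Fin ℓ) (ψ : RefSpace d ℓ)
    (s : Config d ℓ) :
    (matrixUnit Λ u v ψ) s = if restrictTo Λ s = u then ψ (overwrite Λ v s) else 0 := by
  rw [matrixUnit, pullback_apply]
  by_cases h : restrictTo Λ s = u <;> simp [h]

/-- The action of a matrix `M ∈ ⨂_{x ∈ Λ} M_ℓ(ℂ) = M_{Λ → Fin ℓ}(ℂ)` on `ℓ²(Config)`. -/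
def localOp (Λ : Finset (SpinLattice d)) (M : Matrix (Λ → Fin ℓ) (Λ → Fin ℓ) ℂ) : RefOp d ℓ :=
  ∑ u, ∑ v, M u v • matrixUnit Λ u v

theorem localOp_apply (Λ : Finset (SpinLattice d)) (M : Matrix (Λ → Fin ℓ) (Λ → Fin ℓ) ℂ)
    (ψ : RefSpace d ℓ) (s : Config d ℓ) :
    (localOp Λ M ψ) s = ∑ v, M (restrictTo Λ s) v * ψ (overwrite Λ v s) := by
  have h : (localOp Λ M ψ) s = ∑ u, ∑ v, M u v * (matrixUnit Λ u v ψ) s := by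
    simp only [localOp, sum_apply, lp.coeFn_sum, Finset.sum_apply]
    rfl
  rw [h, Finset.sum_eq_single (restrictTo Λ s)]
  · simp [matrixUnit_apply]
  · intro u _ hu
    simp [matrixUnit_apply, hu.symm]
  · simp

theorem localOp_one (Λ : Finset (SpinLattice d)) :
    localOp Λ (1 : Matrix (Λ → Fin ℓ) (Λ → Fin ℓ) ℂ) = 1 := by
  ext ψ s
  rw [localOp_apply]
  simp [Matrix.one_apply, overwrite_restrictTo]

theorem localOp_mul (Λ : Finset (SpinLattice d)) (M M' : Matrix (Λ → Fin ℓ) (Λ → Fin ℓ) ℂ) :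
    localOp Λ (M * M') = localOp Λ M * localOp Λ M' := by
  ext ψ s
  simp only [localOp_apply, mul_apply_eq_comp, restrictTo_overwrite,
    overwrite_overwrite, Matrix.mul_apply, Finset.sum_mul, Finset.mul_sum]
  rw [Finset.sum_comm]
  simp only [mul_assoc]

theorem localOp_add (Λ : Finset (SpinLattice d)) (M M' : Matrix (Λ → Fin ℓ) (Λ → Fin ℓ) ℂ) :
    localOp Λ (M + M') = localOp Λ M + localOp Λ M' := by
  simp [localOp, add_smul, Finset.sum_add_distrib]

theorem localOp_smul (Λ : Finset (SpinLattice d)) (c : ℂ)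
    (M : Matrix (Λ → Fin ℓ) (Λ → Fin ℓ) ℂ) :
    localOp Λ (c • M) = c • localOp Λ M := by
  simp [localOp, mul_smul, Finset.smul_sum]

theorem inner_matrixUnit (Λ : Finset (SpinLattice d)) (u v : Λ → Fin ℓ) (ψ φ : RefSpace d ℓ) :
    ⟪matrixUnit Λ v u ψ, φ⟫_ℂ = ⟪ψ, matrixUnit Λ u v φ⟫_ℂ := by
  rw [lp.inner_eq_tsum, lp.inner_eq_tsum]
  let e : {s : Config d ℓ // restrictTo Λ s = v} ≃ {s : Config d ℓ // restrictTo Λ s = u} :=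
    { toFun := fun s => ⟨overwrite Λ u s, restrictTo_overwrite Λ u s⟩
      invFun := fun s => ⟨overwrite Λ v s, restrictTo_overwrite Λ v s⟩
      left_inv := fun s => Subtype.ext (by
        have := overwrite_restrictTo Λ s.1
        rw [s.2] at this
        simpa [overwrite_overwrite] using this)
      right_inv := fun s => Subtype.ext (by
        have := overwrite_restrictTo Λ s.1
        rw [s.2] at this
        simpa [overwrite_overwrite] using this) }
  have h1 : ∑' s, ⟪(matrixUnit Λ v u ψ) s, φ s⟫_ℂ
      = ∑' s : {s : Config d ℓ // restrictTo Λ s = v}, ⟪ψ (overwrite Λ u s), φ s⟫_ℂ := by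
    rw [← tsum_subtype_eq_of_support_subset (s := {s : Config d ℓ | restrictTo Λ s = v})]
    · refine tsum_congr fun s => ?_
      have hs : restrictTo Λ s.1 = v := s.2
      simp [matrixUnit_apply, hs]
    · intro s hs
      by_contra h
      exact hs (by simp [matrixUnit_apply, show ¬ restrictTo Λ s = v from h])
  have h2 : ∑' s, ⟪ψ s, (matrixUnit Λ u v φ) s⟫_ℂ
      = ∑' s : {s : Config d ℓ // restrictTo Λ s = u}, ⟪ψ s, φ (overwrite Λ v s)⟫_ℂ := by
    rw [← tsum_subtype_eq_of_support_subset (s := {s : Config d ℓ | restrictTo Λ s = u})]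
    · refine tsum_congr fun s => ?_
      have hs : restrictTo Λ s.1 = u := s.2
      simp [matrixUnit_apply, hs]
    · intro s hs
      by_contra h
      exact hs (by simp [matrixUnit_apply, show ¬ restrictTo Λ s = u from h])
  rw [h1, h2, ← e.tsum_eq]
  refine tsum_congr fun s => ?_
  have := overwrite_restrictTo Λ s.1
  rw [s.2] at this
  simp [e, overwrite_overwrite, this]

theorem localOp_star (Λ : Finset (SpinLattice d)) (M : Matrix (Λ → Fin ℓ) (Λ → Fin ℓ) ℂ) :
    localOp Λ (star M) = star (localOp Λ M) := by
  have h : ∀ u v : Λ → Fin ℓ, star (matrixUnit Λ u v : RefOp d ℓ) = matrixUnit Λ v u := by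
    intro u v
    rw [ContinuousLinearMap.star_eq_adjoint, eq_comm, ContinuousLinearMap.eq_adjoint_iff]
    exact inner_matrixUnit Λ u v
  simp only [localOp, star_sum, star_smul, h]
  rw [Finset.sum_comm]
  rfl

/-- The representation of `⨂_{x ∈ Λ} M_ℓ(ℂ)` on `ℓ²(Config)`. -/
def localRep (Λ : Finset (SpinLattice d)) :
    Matrix (Λ → Fin ℓ) (Λ → Fin ℓ) ℂ →⋆ₐ[ℂ] RefOp d ℓ where
  toFun := localOp Λ
  map_one' := localOp_one Λ
  map_mul' := localOp_mul Λ
  map_zero' := by simp [localOp]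
  map_add' := localOp_add Λ
  commutes' c := by
    rw [Algebra.algebraMap_eq_smul_one, Algebra.algebraMap_eq_smul_one, localOp_smul, localOp_one]
  map_star' := localOp_star Λ

/-- The algebra `𝔄(Λ)` of the observables localized in the finite region `Λ`. -/
def localAlgebra (ℓ : ℕ) (Λ : Finset (SpinLattice d)) : StarSubalgebra ℂ (RefOp d ℓ) :=
  (localRep Λ).range

/-- The quasilocal algebra as a set of operators: the norm closure of the algebra of all local
observables. -/
def quasiLocal (d ℓ : ℕ) : StarSubalgebra ℂ (RefOp d ℓ) :=
  (⨆ Λ : Finset (SpinLattice d), localAlgebra ℓ Λ).topologicalClosure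

/-- The quasilocal algebra `𝔄`, as a type. -/
abbrev Observable (d ℓ : ℕ) : Type := quasiLocal d ℓ

instance : CompleteSpace (Observable d ℓ) :=
  inferInstanceAs
    (CompleteSpace (⨆ Λ : Finset (SpinLattice d), localAlgebra ℓ Λ).topologicalClosure)

/-- `A ∈ 𝔄` is localized in the finite region `Λ`, that is `A ∈ 𝔄(Λ)`. -/
def IsLocalIn (A : Observable d ℓ) (Λ : Finset (SpinLattice d)) : Prop :=
  (A : RefOp d ℓ) ∈ localAlgebra ℓ Λ

/-! ## Space translations -/

/-- `(shiftOp x ψ)(s) = ψ(s(· + x))`. -/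
def shiftOp (x : SpinLattice d) : RefOp d ℓ :=
  pullback (fun s : Config d ℓ => fun y => s (y + x)) Set.univ (by
    intro s _ t _ h
    funext y
    simpa using congrFun h (y - x))

theorem shiftOp_apply (x : SpinLattice d) (ψ : RefSpace d ℓ) (s : Config d ℓ) :
    (shiftOp x ψ) s = ψ (fun y => s (y + x)) := by
  refine (pullback_apply _ _ _ _ _).trans ?_
  rw [Set.indicator_univ]

theorem shiftOp_mul_neg (x : SpinLattice d) : shiftOp x * shiftOp (-x) = (1 : RefOp d ℓ) := by
  ext ψ s
  simp [shiftOp_apply]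

theorem star_shiftOp (x : SpinLattice d) : star (shiftOp x : RefOp d ℓ) = shiftOp (-x) := by
  rw [ContinuousLinearMap.star_eq_adjoint, eq_comm, ContinuousLinearMap.eq_adjoint_iff]
  intro ψ φ
  rw [lp.inner_eq_tsum, lp.inner_eq_tsum]
  let e : Config d ℓ ≃ Config d ℓ :=
    { toFun := fun s y => s (y + -x)
      invFun := fun s y => s (y + x)
      left_inv := fun s => by funext y; simp
      right_inv := fun s => by funext y; simp }
  rw [← e.tsum_eq (fun s => ⟪ψ s, (shiftOp x φ) s⟫_ℂ)]
  refine tsum_congr fun s => ?_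
  simp [shiftOp_apply, e]

/-- The unitary on `ℓ²(Config)` which translates by `x`. -/
def shiftUnitary (x : SpinLattice d) : unitary (RefOp d ℓ) :=
  ⟨shiftOp x, by
    rw [Unitary.mem_iff, star_shiftOp]
    exact ⟨by simpa using shiftOp_mul_neg (ℓ := ℓ) (-x), shiftOp_mul_neg x⟩⟩

/-- The region `Λ + x`. -/
def translateRegion (x : SpinLattice d) (Λ : Finset (SpinLattice d)) : Finset (SpinLattice d) :=
  Λ.map (Equiv.addRight x).toEmbedding

theorem mem_translateRegion {x y : SpinLattice d} {Λ : Finset (SpinLattice d)} :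
    y ∈ translateRegion x Λ ↔ y - x ∈ Λ := by
  simp [translateRegion, sub_eq_add_neg]

theorem conj_shift_matrixUnit (x : SpinLattice d) (Λ : Finset (SpinLattice d)) (u v : Λ → Fin ℓ) :
    shiftOp x * matrixUnit Λ u v * shiftOp (-x) =
      matrixUnit (translateRegion x Λ)
        (fun y => u ⟨y.1 - x, mem_translateRegion.1 y.2⟩)
        (fun y => v ⟨y.1 - x, mem_translateRegion.1 y.2⟩) := by
  ext ψ s
  simp only [mul_apply_eq_comp, shiftOp_apply, matrixUnit_apply]
  have h1 : (restrictTo Λ (fun y => s (y + x)) = u) ↔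
      restrictTo (translateRegion x Λ) s =
        fun y => u ⟨y.1 - x, mem_translateRegion.1 y.2⟩ := by
    constructor
    · intro h
      funext y
      rw [← h]
      simp [restrictTo]
    · intro h
      funext y
      have := congrFun h ⟨y.1 + x, mem_translateRegion.2 (by simp)⟩
      simpa [restrictTo] using this
  have h2 : (fun y => overwrite Λ v (fun y => s (y + x)) (y + -x)) =
      overwrite (translateRegion x Λ)
        (fun y => v ⟨y.1 - x, mem_translateRegion.1 y.2⟩) s := by
    funext y
    by_cases hy : y - x ∈ Λ
    · have hy' : y + -x ∈ Λ := by rwa [← sub_eq_add_neg]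
      simp [overwrite, mem_translateRegion, hy', sub_eq_add_neg]
    · have hy' : y + -x ∉ Λ := by rwa [← sub_eq_add_neg]
      simp [overwrite, mem_translateRegion, hy, hy']
  rw [h2]
  by_cases h : restrictTo Λ (fun y => s (y + x)) = u
  · rw [if_pos h, if_pos (h1.1 h)]
  · rw [if_neg h, if_neg (fun h' => h (h1.2 h'))]

theorem matrixUnit_mem (Λ : Finset (SpinLattice d)) (u v : Λ → Fin ℓ) :
    matrixUnit Λ u v ∈ localAlgebra ℓ Λ := by
  classical
  refine ⟨Matrix.single u v 1, ?_⟩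
  change localOp Λ (Matrix.single u v 1) = _
  ext ψ s
  rw [localOp_apply, matrixUnit_apply]
  by_cases h : restrictTo Λ s = u
  · subst h
    simp [Matrix.single_apply]
  · simp [h, Ne.symm h]

theorem conj_shift_mem_local (x : SpinLattice d) (Λ : Finset (SpinLattice d)) {A : RefOp d ℓ}
    (hA : A ∈ localAlgebra ℓ Λ) :
    Unitary.conjStarAlgAut ℂ (RefOp d ℓ) (shiftUnitary x) A ∈
      localAlgebra ℓ (translateRegion x Λ) := by
  obtain ⟨M, rfl⟩ := hA
  change shiftOp x * localOp Λ M * star (shiftOp x) ∈ _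
  rw [star_shiftOp]
  simp only [localOp, Finset.mul_sum, Finset.sum_mul, mul_smul_comm, smul_mul_assoc,
    conj_shift_matrixUnit]
  exact sum_mem fun u _ => sum_mem fun v _ => SMulMemClass.smul_mem _ (matrixUnit_mem _ _ _)

theorem conj_shift_mem (x : SpinLattice d) {A : RefOp d ℓ} (hA : A ∈ quasiLocal d ℓ) :
    Unitary.conjStarAlgAut ℂ (RefOp d ℓ) (shiftUnitary x) A ∈ quasiLocal d ℓ := by
  have hloc : (⨆ Λ : Finset (SpinLattice d), localAlgebra ℓ Λ) ≤
      (⨆ Λ : Finset (SpinLattice d), localAlgebra ℓ Λ).comap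
        (Unitary.conjStarAlgAut ℂ (RefOp d ℓ) (shiftUnitary x) : RefOp d ℓ →⋆ₐ[ℂ] RefOp d ℓ) :=
    iSup_le fun Λ B hB =>
      le_iSup (fun Λ : Finset (SpinLattice d) => localAlgebra ℓ Λ) (translateRegion x Λ)
        (conj_shift_mem_local x Λ hB)
  have hcont : Continuous (Unitary.conjStarAlgAut ℂ (RefOp d ℓ) (shiftUnitary x)) := by
    change Continuous fun A : RefOp d ℓ => shiftOp x * A * star (shiftOp x)
    fun_prop
  exact map_mem_closure hcont hA fun B hB => hloc hB

/-- The automorphism `τ_x` of `𝔄` which translates by `x ∈ Γ`; it maps `𝔄(Λ)` onto `𝔄(Λ + x)`. -/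
def latticeTranslate (x : SpinLattice d) (A : Observable d ℓ) : Observable d ℓ :=
  ⟨Unitary.conjStarAlgAut ℂ (RefOp d ℓ) (shiftUnitary x) A, conj_shift_mem x A.2⟩

/-! ## Interactions and dynamics -/

/-- An interaction: a self-adjoint `Φ(X) ∈ 𝔄(X)` for each finite region `X`. -/
structure Interaction (d ℓ : ℕ) where
  toFun : Finset (SpinLattice d) → Observable d ℓ
  isLocalIn : ∀ X, IsLocalIn (toFun X) X
  isSelfAdjoint : ∀ X, IsSelfAdjoint (toFun X)

namespace Interaction

/-- `Φ(X + x) = τ_x(Φ(X))`. -/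
def IsTranslationInvariant (Φ : Interaction d ℓ) : Prop :=
  ∀ (x : SpinLattice d) (X : Finset (SpinLattice d)),
    Φ.toFun (translateRegion x X) = latticeTranslate x (Φ.toFun X)

/-- `‖Φ‖_λ = sup_x ∑_{X ∋ x, 0} ‖Φ(X)‖ / F_λ(|x|)`, where `F_λ(r) = e^{-λ r} F(r)` and
`|·| = N`. -/
def decayNorm (Φ : Interaction d ℓ) (N : AddGroupNorm (SpinLattice d)) (F : ℝ → ℝ) (lam : ℝ) :
    ℝ≥0∞ :=
  ⨆ x : SpinLattice d, ∑' X : {X : Finset (SpinLattice d) // x ∈ X ∧ 0 ∈ X},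
    ENNReal.ofReal (‖Φ.toFun X.1‖ / (Real.exp (-lam * N x) * F (N x)))

/-- The local Hamiltonian `H_Λ = ∑_{X ⊆ Λ} Φ(X)`. -/
def localHamiltonian (Φ : Interaction d ℓ) (Λ : Finset (SpinLattice d)) : Observable d ℓ :=
  ∑ X ∈ Λ.powerset, Φ.toFun X

/-- The local dynamics `τ^Λ_t(A) = e^{i t H_Λ} A e^{-i t H_Λ}`. -/
def localEvolution (Φ : Interaction d ℓ) (Λ : Finset (SpinLattice d)) (t : ℝ)
    (A : Observable d ℓ) : Observable d ℓ :=
  NormedSpace.exp ((Complex.I * t) • Φ.localHamiltonian Λ) * A *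
    NormedSpace.exp (-((Complex.I * t) • Φ.localHamiltonian Λ))

/-- The global dynamics `τ_t(A) = lim_{Λ ↗ Γ} τ^Λ_t(A)` (limit in norm along the directed set of
the finite regions). -/
def evolution (Φ : Interaction d ℓ) (t : ℝ) (A : Observable d ℓ) : Observable d ℓ :=
  limUnder atTop fun Λ : Finset (SpinLattice d) => Φ.localEvolution Λ t A

/-- The space-time translations `τ_{(t,x)} = τ_t ∘ τ_x`. -/
def spacetime (Φ : Interaction d ℓ) (g : ℝ × SpinLattice d) (A : Observable d ℓ) :
    Observable d ℓ :=
  Φ.evolution g.1 (latticeTranslate g.2 A)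

end Interaction

/-- The conditions on `F : [0, ∞) → (0, ∞)`: it is non-increasing, `∑_x F(|x|) < ∞` and
`sup_{x,y} ∑_z F(|z - x|) F(|y - z|) / F(|y - x|) < ∞`, where `|·| = N`. -/
structure IsDecayFunction (N : AddGroupNorm (SpinLattice d)) (F : ℝ → ℝ) : Prop where
  pos : ∀ r, 0 ≤ r → 0 < F r
  antitone : AntitoneOn F (Set.Ici 0)
  summable : ∑' x : SpinLattice d, ENNReal.ofReal (F (N x)) < ⊤
  convolution : ⨆ (x : SpinLattice d) (y : SpinLattice d), ∑' z : SpinLattice d,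
    ENNReal.ofReal (F (N (z - x)) * F (N (y - z)) / F (N (y - x))) < ⊤

/-! ## The dual group, Fourier transforms and the Arveson spectrum -/

/-- The dual group `ℝ × Γ̂` of `ℝ × Γ`, where `Γ̂ = (ℝ / 2πℤ)^d`. -/
abbrev Dual (d : ℕ) : Type := ℝ × (Fin d → AddCircle (2 * Real.pi))

/-- `e^{i E t - i p x}` for `q = (E, p)` and `g = (t, x)`. -/
def phase (q : Dual d) (g : ℝ × SpinLattice d) : ℂ :=
  Complex.exp (Complex.I * (q.1 * g.1 : ℝ)) * (AddCircle.toCircle (-∑ i, g.2 i • q.2 i) : ℂ)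

/-- The Haar measure `(2π)^{-(d+1)/2} ∑_x ∫ dt` of `ℝ × Γ`. -/
def haar (d : ℕ) : Measure (ℝ × SpinLattice d) :=
  ENNReal.ofReal ((2 * Real.pi) ^ (-((d : ℝ) + 1) / 2)) •
    (volume : Measure ℝ).prod (Measure.count : Measure (SpinLattice d))

/-- The Fourier transform `f̂(E, p) = (2π)^{-(d+1)/2} ∑_x ∫ dt e^{i E t - i p x} f(t, x)`. -/
def fourier (f : ℝ × SpinLattice d → ℂ) (q : Dual d) : ℂ :=
  ∫ g, phase q g * f g ∂(haar d)

/-- `τ_f(A) = (2π)^{-(d+1)/2} ∑_x ∫ dt f(t, x) τ_{(t,x)}(A)`. -/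
def smear (Φ : Interaction d ℓ) (f : ℝ × SpinLattice d → ℂ) (A : Observable d ℓ) :
    Observable d ℓ :=
  ∫ g, f g • Φ.spacetime g A ∂(haar d)

/-- The Arveson spectrum `Sp_A τ`: the smallest closed set `S` such that `τ_f(A) = 0` whenever
`f ∈ L¹(ℝ × Γ)` and the support of `f̂` is disjoint from `S`. -/
def arvesonSpectrum (Φ : Interaction d ℓ) (A : Observable d ℓ) : Set (Dual d) :=
  ⋂₀ {S | IsClosed S ∧ ∀ f : ℝ × SpinLattice d → ℂ, Integrable f (haar d) →
    Disjoint (tsupport (fourier f)) S → smear Φ f A = 0}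

/-! ## Almost local observables -/

/-- `A` is almost local: there are `A_r ∈ 𝔄(Z^r)`, where `Z^r = {x | |x| ≤ r}` and `|·| = N`, with
`A - A_r = O(r^{-n})` for all `n`. (An observable in `𝔄(Z^r)` is one localized in some finite
subregion of `Z^r`; the balls themselves are finite in the case of interest.) -/
def IsAlmostLocal (N : AddGroupNorm (SpinLattice d)) (A : Observable d ℓ) : Prop :=
  ∃ Ar : ℝ → Observable d ℓ,
    (∀ r, 0 ≤ r → ∃ Λ : Finset (SpinLattice d), (∀ x ∈ Λ, N x ≤ r) ∧ IsLocalIn (Ar r) Λ) ∧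
    ∀ n : ℕ, (fun r => A - Ar r) =O[atTop] fun r : ℝ => (r ^ n)⁻¹

/-! ## States, representations and spectral measures -/

/-- A state on `𝔄` which is invariant under time and space translations. -/
structure IsInvariantState (Φ : Interaction d ℓ) (ω : Observable d ℓ →ₗ[ℂ] ℂ) : Prop where
  nonneg : ∀ A, 0 ≤ ω (star A * A)
  map_one : ω 1 = 1
  evolution : ∀ t A, ω (Φ.evolution t A) = ω A
  translation : ∀ x A, ω (latticeTranslate x A) = ω A

section Hilbert

variable {H : Type*} [NormedAddCommGroup H] [InnerProductSpace ℂ H] [CompleteSpace H]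

/-- `(π, H, Ω)` is the Gelfand-Naimark-Segal representation of `ω`: the vector `Ω` is cyclic and
`ω(A) = ⟨Ω, π(A) Ω⟩`. -/
structure IsGNS (ω : Observable d ℓ →ₗ[ℂ] ℂ) (π : Observable d ℓ →⋆ₐ[ℂ] (H →L[ℂ] H)) (Ω : H) :
    Prop where
  inner_eq : ∀ A, ⟪Ω, π A Ω⟫_ℂ = ω A
  cyclic : Dense (Set.range fun A => π A Ω)

/-- `U` is a (strongly continuous) unitary representation of the space-time translations which
implements `τ` in `π` and leaves `Ω` invariant. -/
structure IsImplementation (Φ : Interaction d ℓ) (π : Observable d ℓ →⋆ₐ[ℂ] (H →L[ℂ] H)) (Ω : H)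
    (U : ℝ × SpinLattice d → unitary (H →L[ℂ] H)) : Prop where
  map_add : ∀ g h, U (g + h) = U g * U h
  continuous : ∀ ψ : H, Continuous fun g => (U g : H →L[ℂ] H) ψ
  implements : ∀ g A, π (Φ.spacetime g A) = (U g : H →L[ℂ] H) * π A * star (U g : H →L[ℂ] H)
  map_vacuum : ∀ g, (U g : H →L[ℂ] H) Ω = Ω

/-- The generator `𝓗` of the time translations `U(t) = e^{i t 𝓗}` is positive. A vector `ψ` is in
the domain of `𝓗`, with `𝓗 ψ = η`, if `t ↦ U(t) ψ` has the derivative `i η` at `t = 0`. -/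
def HasPositiveEnergy (U : ℝ × SpinLattice d → unitary (H →L[ℂ] H)) : Prop :=
  ∀ ψ η : H, HasDerivAt (fun t : ℝ => (U (t, 0) : H →L[ℂ] H) ψ) (Complex.I • η) 0 →
    0 ≤ ⟪ψ, η⟫_ℂ

/-- A projection-valued (spectral) measure on `X` with values in the projections of `H`. -/
structure SpectralMeasure (X : Type*) [MeasurableSpace X] (H : Type*) [NormedAddCommGroup H]
    [InnerProductSpace ℂ H] [CompleteSpace H] where
  proj : Set X → H →L[ℂ] H
  isStarProjection : ∀ S, MeasurableSet S → IsStarProjection (proj S)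
  univ : proj Set.univ = 1
  inter : ∀ S T, MeasurableSet S → MeasurableSet T → proj (S ∩ T) = proj S * proj T
  iUnion : ∀ S : ℕ → Set X, (∀ i, MeasurableSet (S i)) → Pairwise (Function.onFun Disjoint S) →
    ∀ ψ, HasSum (fun i => proj (S i) ψ) (proj (⋃ i, S i) ψ)

namespace SpectralMeasure

variable {X : Type*} [MeasurableSpace X]

theorem re_inner_nonneg (P : SpectralMeasure X H) (ψ : H) {S : Set X} (hS : MeasurableSet S) :
    0 ≤ (⟪ψ, P.proj S ψ⟫_ℂ).re :=
  (ContinuousLinearMap.IsPositive.of_isStarProjection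
    (P.isStarProjection S hS)).re_inner_nonneg_right ψ

theorem hasSum_re_inner (P : SpectralMeasure X H) (ψ : H) {S : ℕ → Set X}
    (hS : ∀ i, MeasurableSet (S i)) (hd : Pairwise (Function.onFun Disjoint S)) :
    HasSum (fun i => (⟪ψ, P.proj (S i) ψ⟫_ℂ).re) (⟪ψ, P.proj (⋃ i, S i) ψ⟫_ℂ).re :=
  Complex.hasSum_re ((P.iUnion S hS hd ψ).mapL (innerSL ℂ ψ))

theorem proj_empty (P : SpectralMeasure X H) : P.proj ∅ = 0 := by
  ext ψ
  have h := P.iUnion (fun _ => ∅) (fun _ => MeasurableSet.empty)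
    (fun _ _ _ => disjoint_bot_left) ψ
  exact tendsto_nhds_unique tendsto_const_nhds h.summable.tendsto_atTop_zero

/-- The finite measure `S ↦ ⟨ψ, P(S) ψ⟩`. -/
def scalarMeasure (P : SpectralMeasure X H) (ψ : H) : Measure X :=
  Measure.ofMeasurable (fun S _ => ENNReal.ofReal (⟪ψ, P.proj S ψ⟫_ℂ).re)
    (by simp [P.proj_empty])
    (fun S hS hd => by
      rw [← (P.hasSum_re_inner ψ hS hd).tsum_eq]
      exact ENNReal.ofReal_tsum_of_nonneg (fun i => P.re_inner_nonneg ψ (hS i))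
        (P.hasSum_re_inner ψ hS hd).summable)

/-- The support: the points all of whose open neighbourhoods have a non-zero projection. -/
def support [TopologicalSpace X] (P : SpectralMeasure X H) : Set X :=
  {q | ∀ O : Set X, IsOpen O → q ∈ O → P.proj O ≠ 0}

end SpectralMeasure

/-- `P` is the spectral measure of `U`, that is `U(t, x) = ∫ e^{i E t - i p x} dP(E, p)`; the
equation is stated for the matrix elements `⟨ψ, · ψ⟩`, which determine an operator. -/
def IsSpectralMeasureOf (P : SpectralMeasure (Dual d) H)
    (U : ℝ × SpinLattice d → unitary (H →L[ℂ] H)) : Prop :=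
  ∀ g ψ, ⟪ψ, (U g : H →L[ℂ] H) ψ⟫_ℂ = ∫ q, phase q g ∂(P.scalarMeasure ψ)

end Hilbert

end

end SpinSystem

open SpinSystem

/-! Write `B x = π (τ_x A)` and `Q = ∑ B_x^* B_x` over a finite region. The proof combines an energy
argument with an algebraic one.

Energy. The Arveson spectrum of `A` is compact in the open lower half space, so it lies in `E ≤ -ε`
for some `ε > 0`, and every `B x` lowers the energy by at least `ε`
(`EnergyLE.representation_apply`). Vectors in the range of `P(Δ)` have energy at most some `a`, and
positivity of the generator excludes negative energies (`proj_negative_eq_zero`). Hence every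
product of `n > a / ε` operators `B x` annihilates these vectors (`EnergyLE.annihilatedBy`), with
`n` independent of the region.

Algebra. If all `n`-fold products annihilate `ψ`, then `‖Q ψ‖ ≤ n D ‖ψ‖`, where `D` bounds the row
and column sums of the commutator norms (`AnnihilatedBy.norm_sum_le`). The induction expands `‖Q
ψ‖²` and moves `B_x` past `B_y^*`: the commutators contribute `D ∑ ‖B_x ψ‖²`, and what remains is `∑
‖B_y B_x ψ‖²`, where the induction hypothesis applies to each `B_x ψ`. By translation covariance the
commutators depend only on `x - y`, so `D` may be taken as the sum over `Λ - Λ`.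

For almost local `A` the commutator norms are summable over the whole lattice
(`summable_commutator`), so `D` does not depend on the region, and uniformly bounded sums of
positive operators converge strongly (`exists_hasSum_star_mul_self`).

The analytic work lies in passing from the Arveson spectrum to energy transfer without an unbounded
generator. Vectors are smeared with Schwartz functions of compact band, which acts as a functional
calculus in the energy (`inner_timeSmear`), and `smear_time_eq_zero` uses a partition of unity on
energy-momentum space to show that smearing `A` with bands above `-ε` gives zero. -/

/-! ### Bounds on sums of positive operators in a Hilbert space. -/

section OperatorSums

variable {H : Type*} [NormedAddCommGroup H] [InnerProductSpace ℂ H] [CompleteSpace H]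

/-- All products of `n` operators from the family `B` with indices in `s` annihilate `ψ`. -/
def AnnihilatedBy {ι : Type*} (s : Finset ι) (B : ι → H →L[ℂ] H) : ℕ → H → Prop
  | 0, ψ => ψ = 0
  | n + 1, ψ => ∀ x ∈ s, AnnihilatedBy s B n (B x ψ)

theorem re_inner_sum_star_mul_self {ι : Type*} (s : Finset ι) (B : ι → H →L[ℂ] H) (ψ : H) :
    (⟪ψ, (∑ x ∈ s, star (B x) * B x) ψ⟫_ℂ).re = ∑ x ∈ s, ‖B x ψ‖ ^ 2 := by
  rw [sum_apply, inner_sum, Complex.re_sum]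
  refine Finset.sum_congr rfl fun x _ => ?_
  rw [mul_apply_eq_comp, ContinuousLinearMap.star_eq_adjoint,
    ContinuousLinearMap.adjoint_inner_right]
  exact inner_self_eq_norm_sq (𝕜 := ℂ) (B x ψ)

/-- Cauchy-Schwarz for the quadratic form of `∑ B_x^* B_x`; it converts a bound on the operator
applied to a vector into a bound on the square sum, which is what the induction feeds on. -/
theorem sum_norm_sq_le_inner {ι : Type*} (s : Finset ι) (B : ι → H →L[ℂ] H) (ψ : H) :
    ∑ x ∈ s, ‖B x ψ‖ ^ 2 ≤ ‖ψ‖ * ‖(∑ x ∈ s, star (B x) * B x) ψ‖ := by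
  rw [← re_inner_sum_star_mul_self]
  exact (Complex.re_le_norm _).trans (norm_inner_le_norm _ _)

/-- The norm of `Q ψ` with `Q = ∑ B_x^* B_x`, after commuting `B_x` with `B_y^*`. -/
theorem norm_sq_sum_star_mul_self_le {ι : Type*} (s : Finset ι) (B : ι → H →L[ℂ] H)
    (c : ι → ι → ℝ) (D : ℝ)
    (hc : ∀ x ∈ s, ∀ y ∈ s, ‖B x * star (B y) - star (B y) * B x‖ ≤ c x y)
    (hrow : ∀ x ∈ s, ∑ y ∈ s, c x y ≤ D) (hcol : ∀ y ∈ s, ∑ x ∈ s, c x y ≤ D) (ψ : H) :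
    ‖(∑ x ∈ s, star (B x) * B x) ψ‖ ^ 2 ≤
      ∑ x ∈ s, ∑ y ∈ s, ‖B y (B x ψ)‖ ^ 2 + D * ∑ x ∈ s, ‖B x ψ‖ ^ 2 := by
  have key : ∀ x ∈ s, ∀ y ∈ s,
      (⟪(star (B x) * B x) ψ, (star (B y) * B y) ψ⟫_ℂ).re ≤
        (‖B y (B x ψ)‖ ^ 2 + ‖B x (B y ψ)‖ ^ 2) / 2 +
          c x y * ((‖B x ψ‖ ^ 2 + ‖B y ψ‖ ^ 2) / 2) := by
    intro x hx y hy
    -- Moving `B_x^*` to the right and `B_x` past `B_y^*` leaves a product of two-fold products plus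
    -- a commutator term.
    have e : ⟪(star (B x) * B x) ψ, (star (B y) * B y) ψ⟫_ℂ =
        ⟪B y (B x ψ), B x (B y ψ)⟫_ℂ +
          ⟪B x ψ, (B x * star (B y) - star (B y) * B x) (B y ψ)⟫_ℂ := by
      simp only [mul_apply_eq_comp, ContinuousLinearMap.star_eq_adjoint, sub_apply, inner_sub_right]
      rw [ContinuousLinearMap.adjoint_inner_left,
        ContinuousLinearMap.adjoint_inner_right (B y) (B x ψ) (B x (B y ψ))]
      ring
    rw [e, Complex.add_re]
    refine add_le_add ?_ ?_
    · have h1 := (Complex.re_le_norm _).trans (norm_inner_le_norm (𝕜 := ℂ) (B y (B x ψ)) (B x (B y ψ)))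
      nlinarith [sq_nonneg (‖B y (B x ψ)‖ - ‖B x (B y ψ)‖)]
    · have h0 := hc x hx y hy
      have h0' : 0 ≤ c x y := (norm_nonneg _).trans h0
      calc (⟪B x ψ, (B x * star (B y) - star (B y) * B x) (B y ψ)⟫_ℂ).re
          ≤ ‖B x ψ‖ * ‖(B x * star (B y) - star (B y) * B x) (B y ψ)‖ :=
            (Complex.re_le_norm _).trans (norm_inner_le_norm (𝕜 := ℂ) _ _)
        _ ≤ ‖B x ψ‖ * (c x y * ‖B y ψ‖) := by
            gcongr
            exact (ContinuousLinearMap.le_opNorm _ _).trans (by gcongr)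
        _ = c x y * (‖B x ψ‖ * ‖B y ψ‖) := by ring
        _ ≤ _ := by
            gcongr
            nlinarith [sq_nonneg (‖B x ψ‖ - ‖B y ψ‖)]
  have hsq : ‖(∑ x ∈ s, star (B x) * B x) ψ‖ ^ 2 =
      ∑ x ∈ s, ∑ y ∈ s, (⟪(star (B x) * B x) ψ, (star (B y) * B y) ψ⟫_ℂ).re := by
    rw [← inner_self_eq_norm_sq (𝕜 := ℂ), sum_apply, sum_inner]
    simp only [inner_sum, map_sum]
    rfl
  rw [hsq]
  refine (Finset.sum_le_sum fun x hx => Finset.sum_le_sum fun y hy => key x hx y hy).trans ?_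
  -- Exchanging the summation variables identifies the two halves produced by the
  -- arithmetic-geometric mean inequality.
  have h1 : ∑ x ∈ s, ∑ y ∈ s, (‖B y (B x ψ)‖ ^ 2 + ‖B x (B y ψ)‖ ^ 2) / 2 =
      ∑ x ∈ s, ∑ y ∈ s, ‖B y (B x ψ)‖ ^ 2 := by
    have : ∑ x ∈ s, ∑ y ∈ s, ‖B x (B y ψ)‖ ^ 2 = ∑ x ∈ s, ∑ y ∈ s, ‖B y (B x ψ)‖ ^ 2 :=
      Finset.sum_comm
    simp only [← Finset.sum_div, Finset.sum_add_distrib, this]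
    ring
  have h2 : ∑ x ∈ s, ∑ y ∈ s, c x y * ((‖B x ψ‖ ^ 2 + ‖B y ψ‖ ^ 2) / 2) ≤
      D * ∑ x ∈ s, ‖B x ψ‖ ^ 2 := by
    have e1 : ∑ x ∈ s, ∑ y ∈ s, c x y * ‖B x ψ‖ ^ 2 ≤ D * ∑ x ∈ s, ‖B x ψ‖ ^ 2 := by
      rw [Finset.mul_sum]
      refine Finset.sum_le_sum fun x hx => ?_
      rw [← Finset.sum_mul]
      exact mul_le_mul_of_nonneg_right (hrow x hx) (by positivity)
    have e2 : ∑ x ∈ s, ∑ y ∈ s, c x y * ‖B y ψ‖ ^ 2 ≤ D * ∑ x ∈ s, ‖B x ψ‖ ^ 2 := by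
      rw [Finset.sum_comm, Finset.mul_sum]
      refine Finset.sum_le_sum fun x hx => ?_
      rw [← Finset.sum_mul]
      exact mul_le_mul_of_nonneg_right (hcol x hx) (by positivity)
    have e3 : ∑ x ∈ s, ∑ y ∈ s, c x y * ((‖B x ψ‖ ^ 2 + ‖B y ψ‖ ^ 2) / 2) =
        (∑ x ∈ s, ∑ y ∈ s, c x y * ‖B x ψ‖ ^ 2 + ∑ x ∈ s, ∑ y ∈ s, c x y * ‖B y ψ‖ ^ 2) / 2 := by
      rw [← Finset.sum_add_distrib, Finset.sum_div]
      refine Finset.sum_congr rfl fun x _ => ?_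
      rw [← Finset.sum_add_distrib, Finset.sum_div]
      exact Finset.sum_congr rfl fun y _ => by ring
    rw [e3]
    linarith
  simp only [Finset.sum_add_distrib] at h1 h2 ⊢
  linarith

/-- Buchholz's bound: on the vectors annihilated by `n`-fold products of the operators `B_x`, the
operator `∑ B_x^* B_x` is bounded by `n` times the commutator sums. -/
theorem AnnihilatedBy.norm_sum_le {ι : Type*} {s : Finset ι} {B : ι → H →L[ℂ] H}
    {c : ι → ι → ℝ} {D : ℝ} (hD : 0 ≤ D)
    (hc : ∀ x ∈ s, ∀ y ∈ s, ‖B x * star (B y) - star (B y) * B x‖ ≤ c x y)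
    (hrow : ∀ x ∈ s, ∑ y ∈ s, c x y ≤ D) (hcol : ∀ y ∈ s, ∑ x ∈ s, c x y ≤ D) {n : ℕ} {ψ : H}
    (hψ : AnnihilatedBy s B n ψ) :
    ‖(∑ x ∈ s, star (B x) * B x) ψ‖ ≤ n * D * ‖ψ‖ := by
  induction n generalizing ψ with
  | zero =>
    have : ψ = 0 := hψ
    simp [this]
  | succ n ih =>
    have h1 := norm_sq_sum_star_mul_self_le s B c D hc hrow hcol ψ
    have h2 := sum_norm_sq_le_inner s B ψ
    set q := ‖(∑ x ∈ s, star (B x) * B x) ψ‖ with hq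
    -- Each `B_x ψ` is annihilated by the `n`-fold products, so the induction hypothesis bounds the
    -- inner sums.
    have h3 : ∑ x ∈ s, ∑ y ∈ s, ‖B y (B x ψ)‖ ^ 2 ≤ n * D * ∑ x ∈ s, ‖B x ψ‖ ^ 2 := by
      rw [Finset.mul_sum]
      refine Finset.sum_le_sum fun x hx => ?_
      refine (sum_norm_sq_le_inner s B (B x ψ)).trans ?_
      have := mul_le_mul_of_nonneg_left (ih (hψ x hx)) (norm_nonneg (B x ψ))
      calc _ ≤ _ := this
        _ = _ := by ring
    -- The commutator term raises `n D` to `(n + 1) D`; one factor `q` is then cancelled.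
    have h4 : q ^ 2 ≤ (n + 1) * D * (‖ψ‖ * q) := by
      have : (n + 1) * D * ∑ x ∈ s, ‖B x ψ‖ ^ 2 ≤ (n + 1) * D * (‖ψ‖ * q) := by gcongr
      linarith
    have hq0 : 0 ≤ q := norm_nonneg _
    push_cast
    rcases hq0.eq_or_lt with h | h
    · rw [← h]
      positivity
    · refine le_of_mul_le_mul_right ?_ h
      calc q * q = q ^ 2 := by ring
        _ ≤ _ := h4
        _ = _ := by ring

/-- Uniformly bounded finite sums of the positive operators `C_x^* C_x` converge strongly. -/
theorem exists_hasSum_star_mul_self {ι : Type*} (C : ι → H →L[ℂ] H) (M : ℝ)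
    (hC : ∀ (s : Finset ι) (ψ : H), ∑ x ∈ s, ‖C x ψ‖ ^ 2 ≤ M * ‖ψ‖ ^ 2) :
    ∃ T : H →L[ℂ] H, ∀ ψ, HasSum (fun x => (star (C x) * C x) ψ) (T ψ) := by
  -- Testing the partial sum `χ` against itself and applying the hypothesis to `χ` controls its norm
  -- by the tail of a convergent scalar series; this is what makes the vector series Cauchy.
  have bound : ∀ (s : Finset ι) (ψ : H), ‖∑ x ∈ s, (star (C x) * C x) ψ‖ ^ 2 ≤
      M * ∑ x ∈ s, ‖C x ψ‖ ^ 2 := by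
    intro s ψ
    set χ := ∑ x ∈ s, (star (C x) * C x) ψ with hχ
    set S := ∑ x ∈ s, ‖C x ψ‖ ^ 2 with hS
    have hS0 : 0 ≤ S := by positivity
    have h1 : ‖χ‖ ^ 2 ≤ ∑ x ∈ s, ‖C x χ‖ * ‖C x ψ‖ := by
      rw [← inner_self_eq_norm_sq (𝕜 := ℂ)]
      conv_lhs => rw [hχ, inner_sum, ← hχ]
      rw [map_sum]
      refine Finset.sum_le_sum fun x _ => ?_
      rw [mul_apply_eq_comp, ContinuousLinearMap.star_eq_adjoint,
        ContinuousLinearMap.adjoint_inner_right]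
      exact (Complex.re_le_norm _).trans (norm_inner_le_norm _ _)
    have h2 := Finset.sum_mul_sq_le_sq_mul_sq s (fun x => ‖C x χ‖) (fun x => ‖C x ψ‖)
    have h3 := hC s χ
    have h4 : (‖χ‖ ^ 2) ^ 2 ≤ (M * S) * ‖χ‖ ^ 2 := by
      calc (‖χ‖ ^ 2) ^ 2 ≤ (∑ x ∈ s, ‖C x χ‖ * ‖C x ψ‖) ^ 2 := by gcongr
        _ ≤ _ := h2
        _ ≤ (M * ‖χ‖ ^ 2) * S := by gcongr
        _ = _ := by ring
    rcases (sq_nonneg ‖χ‖).eq_or_lt with h | h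
    · rw [← h]
      -- No sign of `M` is assumed; a negative `M` forces all terms to vanish.
      by_cases hM : 0 ≤ M
      · positivity
      · have h5 := hC s ψ
        have : S ≤ 0 := h5.trans (mul_nonpos_of_nonpos_of_nonneg (by linarith) (by positivity))
        have : S = 0 := le_antisymm this hS0
        simp [this]
    · exact le_of_mul_le_mul_right (by rw [← sq]; exact h4) h
  have hsum : ∀ ψ, Summable fun x => (star (C x) * C x) ψ := by
    intro ψ
    have hs : Summable fun x => ‖C x ψ‖ ^ 2 :=
      summable_of_sum_le (fun x => by positivity) (fun s => hC s ψ)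
    rw [summable_iff_vanishing_norm] at hs ⊢
    intro ε hε
    have hM : 0 < |M| + 1 := by positivity
    obtain ⟨s, hs⟩ := hs (ε ^ 2 / (|M| + 1)) (by positivity)
    refine ⟨s, fun t ht => ?_⟩
    have h1 := hs t ht
    have h0 : 0 ≤ ∑ x ∈ t, ‖C x ψ‖ ^ 2 := by positivity
    rw [Real.norm_eq_abs, abs_of_nonneg h0, lt_div_iff₀ hM] at h1
    refine lt_of_pow_lt_pow_left₀ 2 hε.le ((bound t ψ).trans_lt ?_)
    nlinarith [le_abs_self M]
  have hnorm : ∀ ψ, ‖∑' x, (star (C x) * C x) ψ‖ ≤ |M| * ‖ψ‖ := by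
    intro ψ
    refine le_of_tendsto ((hsum ψ).hasSum.norm) (Eventually.of_forall fun s => ?_)
    refine le_of_sq_le_sq ((bound s ψ).trans ?_) (by positivity)
    have h0 : 0 ≤ ∑ x ∈ s, ‖C x ψ‖ ^ 2 := by positivity
    calc M * ∑ x ∈ s, ‖C x ψ‖ ^ 2 ≤ |M| * ∑ x ∈ s, ‖C x ψ‖ ^ 2 := by gcongr; exact le_abs_self M
      _ ≤ |M| * (|M| * ‖ψ‖ ^ 2) := by
        gcongr
        refine (hC s ψ).trans ?_
        gcongr
        exact le_abs_self M
      _ = _ := by ring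
  refine ⟨LinearMap.mkContinuous
    { toFun := fun ψ => ∑' x, (star (C x) * C x) ψ
      map_add' := fun ψ φ => by
        simp only [map_add]
        exact (hsum ψ).tsum_add (hsum φ)
      map_smul' := fun a ψ => by
        simp only [map_smul, RingHom.id_apply]
        exact (hsum ψ).tsum_const_smul a } |M| hnorm, fun ψ => (hsum ψ).hasSum⟩

end OperatorSums

namespace SpinSystem

/-! ### Structure of the quasilocal algebra. -/

section Lattice

variable {d ℓ : ℕ}

/-! ### The translations are isometric automorphisms -/

theorem coe_latticeTranslate (x : SpinLattice d) (A : Observable d ℓ) :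
    ((latticeTranslate x A : Observable d ℓ) : RefOp d ℓ) =
      shiftOp x * (A : RefOp d ℓ) * shiftOp (-x) := by
  change shiftOp x * (A : RefOp d ℓ) * star (shiftOp x) = _
  rw [star_shiftOp]

theorem shiftOp_add (x y : SpinLattice d) :
    (shiftOp (x + y) : RefOp d ℓ) = shiftOp x * shiftOp y := by
  ext ψ s
  simp [shiftOp_apply, add_comm, add_left_comm]

/-- The translation `τ_x` as a star homomorphism. -/
noncomputable def translateHom (ℓ : ℕ) (x : SpinLattice d) : Observable d ℓ →⋆ₐ[ℂ] Observable d ℓ where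
  toFun := latticeTranslate x
  map_one' := Subtype.ext (map_one (Unitary.conjStarAlgAut ℂ (RefOp d ℓ) (shiftUnitary x)))
  map_mul' A B := Subtype.ext
    (map_mul (Unitary.conjStarAlgAut ℂ (RefOp d ℓ) (shiftUnitary x)) (A : RefOp d ℓ) B)
  map_zero' := Subtype.ext (map_zero (Unitary.conjStarAlgAut ℂ (RefOp d ℓ) (shiftUnitary x)))
  map_add' A B := Subtype.ext
    (map_add (Unitary.conjStarAlgAut ℂ (RefOp d ℓ) (shiftUnitary x)) (A : RefOp d ℓ) B)
  commutes' c := Subtype.ext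
    ((Unitary.conjStarAlgAut ℂ (RefOp d ℓ) (shiftUnitary x)).toAlgEquiv.commutes c)
  map_star' A := Subtype.ext
    (map_star (Unitary.conjStarAlgAut ℂ (RefOp d ℓ) (shiftUnitary x)) (A : RefOp d ℓ))

theorem translateHom_apply (x : SpinLattice d) (A : Observable d ℓ) :
    translateHom ℓ x A = latticeTranslate x A := rfl

theorem latticeTranslate_latticeTranslate (x y : SpinLattice d) (A : Observable d ℓ) :
    latticeTranslate x (latticeTranslate y A) = latticeTranslate (x + y) A := by
  refine Subtype.ext ?_
  simp only [coe_latticeTranslate, shiftOp_add, neg_add_rev, mul_assoc]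

theorem norm_latticeTranslate (x : SpinLattice d) (A : Observable d ℓ) :
    ‖latticeTranslate x A‖ = ‖A‖ := by
  change ‖Unitary.conjStarAlgAut ℂ (RefOp d ℓ) (shiftUnitary x) (A : RefOp d ℓ)‖ = ‖(A : RefOp d ℓ)‖
  exact StarAlgEquiv.norm_map _ _

/-! ### Commuting local algebras -/

theorem matrixUnit_commute {Λ Λ' : Finset (SpinLattice d)} (h : Disjoint Λ Λ')
    (u v : Λ → Fin ℓ) (u' v' : Λ' → Fin ℓ) :
    Commute (matrixUnit Λ u v) (matrixUnit Λ' u' v') := by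
  ext ψ s
  simp only [mul_apply_eq_comp, matrixUnit_apply]
  have h1 : restrictTo Λ' (overwrite Λ v s) = restrictTo Λ' s := by
    funext y
    have : y.1 ∉ Λ := fun hy => Finset.disjoint_left.1 h hy y.2
    simp [restrictTo, overwrite, this]
  have h2 : restrictTo Λ (overwrite Λ' v' s) = restrictTo Λ s := by
    funext y
    have : y.1 ∉ Λ' := fun hy => Finset.disjoint_left.1 h y.2 hy
    simp [restrictTo, overwrite, this]
  have h3 : overwrite Λ' v' (overwrite Λ v s) = overwrite Λ v (overwrite Λ' v' s) := by
    funext y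
    by_cases hy : y ∈ Λ
    · have : y ∉ Λ' := fun hy' => Finset.disjoint_left.1 h hy hy'
      simp [overwrite, hy, this]
    · by_cases hy' : y ∈ Λ' <;> simp [overwrite, hy, hy']
  rw [h1, h2, h3]
  by_cases a : restrictTo Λ s = u <;> by_cases b : restrictTo Λ' s = u' <;> simp [a, b]

theorem IsLocalIn.commute {Λ Λ' : Finset (SpinLattice d)} (h : Disjoint Λ Λ')
    {A B : Observable d ℓ} (hA : IsLocalIn A Λ) (hB : IsLocalIn B Λ') : Commute A B := by
  obtain ⟨M, hM⟩ := hA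
  obtain ⟨M', hM'⟩ := hB
  have : Commute (localOp Λ M) (localOp Λ' M') := by
    refine Commute.sum_left _ _ _ fun u _ => Commute.sum_left _ _ _ fun v _ =>
      Commute.sum_right _ _ _ fun u' _ => Commute.sum_right _ _ _ fun v' _ => ?_
    exact ((matrixUnit_commute h u v u' v').smul_left _).smul_right _
  refine Subtype.ext ?_
  change (A : RefOp d ℓ) * B = B * A
  rw [← hM, ← hM']
  exact this

theorem IsLocalIn.star {Λ : Finset (SpinLattice d)} {A : Observable d ℓ} (hA : IsLocalIn A Λ) :
    IsLocalIn (star A) Λ :=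
  by
  change Star.star (A : RefOp d ℓ) ∈ localAlgebra ℓ Λ
  exact star_mem (s := localAlgebra ℓ Λ) hA

theorem IsLocalIn.translate {Λ : Finset (SpinLattice d)} {A : Observable d ℓ} (hA : IsLocalIn A Λ)
    (x : SpinLattice d) : IsLocalIn (latticeTranslate x A) (translateRegion x Λ) :=
  conj_shift_mem_local x Λ hA

/-! ### Separability of the quasilocal algebra -/

/-- The identity on `Λ' \ Λ` is the sum of its diagonal matrix units, so the sum runs over the
extensions `w` of `u` to `Λ'`. -/
theorem matrixUnit_eq_sum {Λ Λ' : Finset (SpinLattice d)} (h : Λ ⊆ Λ') (u v : Λ → Fin ℓ) :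
    matrixUnit Λ u v = ∑ w : Λ' → Fin ℓ, if (fun x : Λ => w ⟨x, h x.2⟩) = u then
      matrixUnit Λ' w (fun y => if hy : y.1 ∈ Λ then v ⟨y, hy⟩ else w y) else 0 := by
  ext ψ s
  simp only [sum_apply, lp.coeFn_sum, Finset.sum_apply, matrixUnit_apply]
  rw [Finset.sum_eq_single (restrictTo Λ' s)]
  · have h1 : (fun x : Λ => restrictTo Λ' s ⟨x, h x.2⟩) = restrictTo Λ s := rfl
    rw [h1]
    by_cases hs : restrictTo Λ s = u
    · rw [if_pos hs, if_pos hs, matrixUnit_apply, if_pos rfl]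
      refine congrArg (ψ : Config d ℓ → ℂ) ?_
      funext y
      by_cases hy : y ∈ Λ
      · simp [overwrite, hy, h hy]
      · by_cases hy' : y ∈ Λ' <;> simp [overwrite, hy, hy', restrictTo]
    · simp [hs]
  · intro w _ hw
    split_ifs with hwu
    · rw [matrixUnit_apply, if_neg (Ne.symm hw)]
    · rfl
  · simp

theorem localAlgebra_mono : Monotone (localAlgebra (d := d) ℓ) := by
  intro Λ Λ' h A hA
  obtain ⟨M, rfl⟩ := hA
  change localOp Λ M ∈ _
  refine sum_mem fun u _ => sum_mem fun v _ => SMulMemClass.smul_mem _ ?_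
  rw [matrixUnit_eq_sum h]
  refine sum_mem fun w _ => ?_
  split_ifs
  · exact matrixUnit_mem _ _ _
  · exact zero_mem _

theorem coe_iSup_localAlgebra :
    ((⨆ Λ : Finset (SpinLattice d), localAlgebra ℓ Λ : StarSubalgebra ℂ (RefOp d ℓ)) : Set (RefOp d ℓ)) =
      ⋃ Λ : Finset (SpinLattice d), (localAlgebra ℓ Λ : Set (RefOp d ℓ)) :=
  StarSubalgebra.coe_iSup_of_directed localAlgebra_mono.directed_le

theorem localOp_continuous (Λ : Finset (SpinLattice d)) :
    Continuous (localOp Λ : Matrix (Λ → Fin ℓ) (Λ → Fin ℓ) ℂ → RefOp d ℓ) := by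
  unfold localOp
  fun_prop

/-- There are countably many finite regions, and each local algebra is a continuous image of a
finite-dimensional space. Separability is what makes the orbits of the dynamics strongly measurable.
-/
theorem isSeparable_quasiLocal : TopologicalSpace.IsSeparable (quasiLocal d ℓ : Set (RefOp d ℓ)) := by
  have h : (quasiLocal d ℓ : Set (RefOp d ℓ)) =
      closure (⋃ Λ : Finset (SpinLattice d), (localAlgebra ℓ Λ : Set (RefOp d ℓ))) := by
    rw [← coe_iSup_localAlgebra]
    rfl
  rw [h]
  refine (TopologicalSpace.IsSeparable.iUnion fun Λ => ?_).closure
  have : (localAlgebra ℓ Λ : Set (RefOp d ℓ)) = Set.range (localOp Λ) := by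
    ext A
    rfl
  rw [this]
  have : TopologicalSpace.SeparableSpace (Matrix (Λ → Fin ℓ) (Λ → Fin ℓ) ℂ) :=
    inferInstanceAs (TopologicalSpace.SeparableSpace ((Λ → Fin ℓ) → (Λ → Fin ℓ) → ℂ))
  exact TopologicalSpace.isSeparable_range (localOp_continuous Λ)

instance : TopologicalSpace.SeparableSpace (Observable d ℓ) :=
  (isSeparable_quasiLocal (d := d) (ℓ := ℓ)).separableSpace

/-- A property of observables which is closed holds if it holds for the local observables. -/
theorem Observable.induction_local {p : Observable d ℓ → Prop} (hp : IsClosed {A | p A})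
    (h : ∀ Λ A, IsLocalIn A Λ → p A) (A : Observable d ℓ) : p A := by
  have hd : A ∈ closure {B : Observable d ℓ | ∃ Λ, IsLocalIn B Λ} := by
    rw [Metric.mem_closure_iff]
    intro ε hε
    have hA : (A : RefOp d ℓ) ∈ closure
        (⋃ Λ : Finset (SpinLattice d), (localAlgebra ℓ Λ : Set (RefOp d ℓ))) := by
      rw [← coe_iSup_localAlgebra]
      exact A.2
    obtain ⟨B, hB, hAB⟩ := Metric.mem_closure_iff.1 hA ε hε
    obtain ⟨Λ, hΛ⟩ := Set.mem_iUnion.1 hB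
    refine ⟨⟨B, StarSubalgebra.le_topologicalClosure _
      (le_iSup (fun Λ : Finset (SpinLattice d) => localAlgebra ℓ Λ) Λ hΛ)⟩, ⟨Λ, hΛ⟩, hAB⟩
  exact closure_minimal (by rintro B ⟨Λ, hB⟩; exact h Λ B hB) hp hd

/-! ### Representations of the quasilocal algebra are isometric -/

variable {H : Type*} [NormedAddCommGroup H] [InnerProductSpace ℂ H] [CompleteSpace H]

/-- The quasilocal algebra is a `C^*`-algebra. -/
@[reducible]
noncomputable def observableCStarAlgebra : CStarAlgebra (Observable d ℓ) :=
  haveI : IsClosed (quasiLocal d ℓ : Set (RefOp d ℓ)) := isClosed_closure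
  StarSubalgebra.cstarAlgebra (quasiLocal d ℓ)

theorem norm_star_observable (A : Observable d ℓ) : ‖star A‖ = ‖A‖ :=
  norm_star (A : RefOp d ℓ)

theorem norm_representation_le (π : Observable d ℓ →⋆ₐ[ℂ] (H →L[ℂ] H)) (A : Observable d ℓ) :
    ‖π A‖ ≤ ‖A‖ :=
  letI : CStarAlgebra (Observable d ℓ) := observableCStarAlgebra
  NonUnitalStarAlgHom.norm_apply_le π A

open scoped Matrix.Norms.L2Operator in
-- A full matrix algebra is simple, so a unital homomorphism into a nonzero algebra is injective,
-- and injective star homomorphisms of `C^*`-algebras are isometric.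
theorem starAlgHom_matrix_norm {n : Type*} [Fintype n] [DecidableEq n] {A : Type*} [CStarAlgebra A]
    [Nontrivial A] (φ : Matrix n n ℂ →⋆ₐ[ℂ] A) (M : Matrix n n ℂ) : ‖φ M‖ = ‖M‖ := by
  refine NonUnitalStarAlgHom.norm_map φ ?_ M
  rcases isEmpty_or_nonempty n with h | h
  · exact fun a b _ => Subsingleton.elim a b
  · exact (φ : Matrix n n ℂ →+* A).injective

theorem representation_continuous (π : Observable d ℓ →⋆ₐ[ℂ] (H →L[ℂ] H)) : Continuous π :=
  AddMonoidHomClass.continuous_of_bound π 1 fun B => by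
    simpa using norm_representation_le π B

/-- The representation of `⨂_{x ∈ Λ} M_ℓ(ℂ)` by observables. -/
noncomputable def localHom (Λ : Finset (SpinLattice d)) :
    Matrix (Λ → Fin ℓ) (Λ → Fin ℓ) ℂ →⋆ₐ[ℂ] Observable d ℓ :=
  (localRep (ℓ := ℓ) Λ).codRestrict _ fun M =>
    StarSubalgebra.le_topologicalClosure _
      (le_iSup (fun Λ : Finset (SpinLattice d) => localAlgebra ℓ Λ) Λ ⟨M, rfl⟩)

theorem IsLocalIn.exists_localHom {Λ : Finset (SpinLattice d)} {A : Observable d ℓ}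
    (hA : IsLocalIn A Λ) : ∃ M, localHom Λ M = A := by
  obtain ⟨M, hM⟩ := hA
  exact ⟨M, Subtype.ext hM⟩

/-- On each local algebra both norms agree with the matrix norm; density of the local observables
does the rest. In particular every representation on a nonzero space is faithful. -/
theorem norm_representation [Nontrivial H] (π : Observable d ℓ →⋆ₐ[ℂ] (H →L[ℂ] H))
    (A : Observable d ℓ) : ‖π A‖ = ‖A‖ := by
  have hn : Nontrivial (Observable d ℓ) := by
    by_contra h
    rw [not_nontrivial_iff_subsingleton] at h
    have h1 : π 1 = π 0 := congrArg π (Subsingleton.elim _ _)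
    rw [map_one, map_zero] at h1
    exact one_ne_zero h1
  refine Observable.induction_local
    (isClosed_eq (representation_continuous π).norm continuous_norm) (fun Λ B hB => ?_) A
  obtain ⟨M, rfl⟩ := hB.exists_localHom
  letI : CStarAlgebra (Observable d ℓ) := observableCStarAlgebra
  exact (starAlgHom_matrix_norm (π.comp (localHom Λ)) M).trans
    (starAlgHom_matrix_norm (localHom Λ) M).symm

end Lattice

end SpinSystem

/-! ### Sums of product functions over powers of an index set. -/

section ProductSums

variable {𝕜 : Type*} [RCLike 𝕜]

theorem summable_norm_and_tsum_pi_prod {α : Type*} (d : ℕ) (f : Fin d → α → 𝕜)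
    (hf : ∀ i, Summable fun n => ‖f i n‖) :
    (Summable fun x : Fin d → α => ‖∏ i, f i (x i)‖) ∧
      ∑' x : Fin d → α, ∏ i, f i (x i) = ∏ i, ∑' n, f i n := by
  induction d with
  | zero =>
    refine ⟨Summable.of_finite, ?_⟩
    rw [tsum_eq_single (default : Fin 0 → α) fun x hx => (hx (Subsingleton.elim _ _)).elim]
    simp
  | succ d ih =>
    obtain ⟨h1, h2⟩ := ih (fun i => f i.succ) (fun i => hf i.succ)
    have e : ∀ p : α × (Fin d → α), ∏ i, f i (Fin.consEquiv (fun _ => α) p i) =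
        f 0 p.1 * ∏ i : Fin d, f i.succ (p.2 i) := by
      intro p
      rw [Fin.prod_univ_succ]
      simp [Fin.consEquiv]
    constructor
    · rw [← (Fin.consEquiv fun _ => α).summable_iff]
      refine (Summable.mul_norm (hf 0) h1).congr fun p => ?_
      rw [Function.comp_apply, e]
    · rw [← (Fin.consEquiv fun _ => α).tsum_eq]
      simp only [e]
      rw [← tsum_mul_tsum_of_summable_norm (hf 0) h1, h2, Fin.prod_univ_succ]

end ProductSums

namespace SpinSystem

/-! ### Summability of commutators of almost local observables. -/

section AlmostLocal

variable {d ℓ : ℕ}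

/-- In the sup norm `(1 + ‖x‖)^(2d)` dominates `∏ (1 + |x_i|)²`, whose reciprocal is a product of
summable functions. -/
theorem summable_one_add_norm_pow (d : ℕ) :
    Summable fun x : SpinLattice d => ((1 + ‖x‖) ^ (2 * d))⁻¹ := by
  have h1 : Summable fun n : ℤ => ‖((1 + |(n : ℝ)|) ^ 2)⁻¹‖ := by
    have hs : Summable fun n : ℤ => (1 / (n : ℝ) ^ 2) :=
      Real.summable_one_div_int_pow.2 (by norm_num)
    refine Summable.of_norm_bounded_eventually hs ?_
    have : ∀ᶠ n : ℤ in cofinite, n ≠ 0 := (Set.finite_singleton 0).eventually_cofinite_notMem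
    filter_upwards [this] with n hn
    have hn' : 0 < |(n : ℝ)| := abs_pos.2 (by exact_mod_cast hn)
    rw [norm_norm, Real.norm_of_nonneg (by positivity), one_div, ← sq_abs (n : ℝ)]
    gcongr
    linarith
  refine (summable_norm_and_tsum_pi_prod d _ fun _ => h1).1.of_nonneg_of_le
    (fun x => by positivity) fun x => ?_
  rw [Finset.prod_inv_distrib, norm_inv, Real.norm_of_nonneg (by positivity)]
  gcongr
  rw [pow_mul]
  calc ∏ i, (1 + |((x i : ℤ) : ℝ)|) ^ 2 ≤ ∏ _i : Fin d, (1 + ‖x‖) ^ 2 := by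
        gcongr with i
        exact norm_le_pi_norm x i
    _ = _ := by simp

/-- Replace `A` by its approximant of radius `|x| / 3`. The approximant and its translate by `x`
live in disjoint regions and commute, so the commutator is of the order of the approximation error,
which decays faster than any power of `|x|`. -/
theorem summable_commutator {N : AddGroupNorm (SpinLattice d)} {c : ℝ} (hc : 0 < c)
    (hN : ∀ x : SpinLattice d, c * ‖x‖ ≤ N x) {A : Observable d ℓ} (hA : IsAlmostLocal N A) :
    Summable fun x : SpinLattice d =>
      ‖star A * latticeTranslate x A - latticeTranslate x A * star A‖ := by
  obtain ⟨Ar, hloc, hO⟩ := hA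
  obtain ⟨K, hK⟩ := (hO (2 * d)).bound
  have hK0 : ∀ᶠ x : SpinLattice d in cofinite, 1 ≤ ‖x‖ ∧ 1 ≤ c * ‖x‖ / 3 ∧
      ‖A - Ar (N x / 3)‖ ≤ |K| * ((N x / 3) ^ (2 * d))⁻¹ := by
    have ht : Tendsto (fun x : SpinLattice d => ‖x‖) cofinite atTop := by
      rw [← cocompact_eq_cofinite]
      exact tendsto_norm_cocompact_atTop
    have ht2 : Tendsto (fun x : SpinLattice d => c * ‖x‖ / 3) cofinite atTop :=
      (ht.const_mul_atTop hc).atTop_div_const (by norm_num)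
    have ht3 : Tendsto (fun x : SpinLattice d => N x / 3) cofinite atTop :=
      tendsto_atTop_mono (fun x => by linarith [hN x]) ht2
    filter_upwards [ht.eventually_ge_atTop 1, ht2.eventually_ge_atTop 1, ht3.eventually hK,
      ht3.eventually_ge_atTop 0] with x h1 h2 h3 h4
    refine ⟨h1, h2, h3.trans ?_⟩
    rw [Real.norm_of_nonneg (by positivity)]
    gcongr
    exact le_abs_self K
  -- The factor `6 / c` comes from `r ≥ c ‖x‖ / 3 ≥ c (1 + ‖x‖) / 6`, valid for `‖x‖ ≥ 1`.
  set C : ℝ := 2 * |K| * (2 * ‖A‖ + |K|) * (6 / c) ^ (2 * d) with hC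
  refine Summable.of_norm_bounded_eventually ((summable_one_add_norm_pow d).mul_left C) ?_
  filter_upwards [hK0] with x ⟨h1, h2, h3⟩
  rw [norm_norm]
  have hNx := hN x
  set r := N x / 3 with hr
  have hr1 : 1 ≤ r := by linarith
  set T := translateHom ℓ x with hT
  obtain ⟨Λ, hΛ, hAr⟩ := hloc r (by linarith)
  -- A common point would give `|x| ≤ 2 r`, whereas `|x| = 3 r` with `r ≥ 1`.
  have hdisj : Disjoint Λ (translateRegion x Λ) := by
    rw [Finset.disjoint_left]
    intro y hy hy'
    have a1 := hΛ y hy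
    have a2 := hΛ _ (mem_translateRegion.1 hy')
    have a3 : N x ≤ N y + N (y - x) := by
      have := map_sub_le_add N y (y - x)
      simpa using this
    linarith
  have hcomm : star (Ar r) * T (Ar r) = T (Ar r) * star (Ar r) :=
    (hAr.star.commute hdisj (hAr.translate x))
  have hTn : ∀ B, ‖T B‖ = ‖B‖ := norm_latticeTranslate x
  set E := A - Ar r with hE
  have hAE : Ar r = A - E := by rw [hE]; abel
  -- The commutator of the two local parts drops out, so every remaining term contains the error
  -- `E`.
  have hid : star A * T A - T A * star A =
      (star E * T A - T A * star E) + (star (Ar r) * T E - T E * star (Ar r)) := by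
    have : star A = star E + star (Ar r) := by rw [← star_add, hE]; simp
    have hTA : T A = T E + T (Ar r) := by rw [← map_add, hE]; simp
    have h0 : star (Ar r) * T A - T A * star (Ar r) = star (Ar r) * T E - T E * star (Ar r) := by
      rw [hTA, mul_add, add_mul, hcomm]
      abel
    rw [← h0, this, add_mul, mul_add]
    abel
  have hEK : ‖E‖ ≤ |K| := by
    refine h3.trans (mul_le_of_le_one_right (abs_nonneg _) (inv_le_one_of_one_le₀ (one_le_pow₀ hr1)))
  have hArn : ‖Ar r‖ ≤ ‖A‖ + |K| := by
    rw [hAE]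
    exact (norm_sub_le _ _).trans (by gcongr)
  have b1 : ‖star A * T A - T A * star A‖ ≤ 2 * (2 * ‖A‖ + |K|) * ‖E‖ := by
    rw [hid]
    have c1 : ∀ X Y : Observable d ℓ, ‖X * Y - Y * X‖ ≤ 2 * (‖X‖ * ‖Y‖) := fun X Y => by
      refine (norm_sub_le _ _).trans ?_
      have := norm_mul_le X Y
      have := norm_mul_le Y X
      linarith [mul_comm ‖X‖ ‖Y‖]
    have d1 := c1 (star E) (T A)
    have d2 := c1 (star (Ar r)) (T E)
    rw [norm_star_observable, hTn] at d1 d2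
    refine (norm_add_le _ _).trans ((add_le_add d1 d2).trans ?_)
    have : ‖Ar r‖ * ‖E‖ ≤ (‖A‖ + |K|) * ‖E‖ := by gcongr
    linarith
  have hfin : (r ^ (2 * d))⁻¹ ≤ (6 / c) ^ (2 * d) * ((1 + ‖x‖) ^ (2 * d))⁻¹ := by
    rw [← inv_pow, ← inv_pow, ← mul_pow]
    gcongr
    rw [inv_le_comm₀ (by linarith) (by positivity), mul_inv, inv_inv, inv_div]
    calc c / 6 * (1 + ‖x‖) ≤ c / 6 * (‖x‖ + ‖x‖) := by gcongr
      _ = c * ‖x‖ / 3 := by ring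
      _ ≤ r := by linarith
  calc ‖star A * T A - T A * star A‖ ≤ 2 * (2 * ‖A‖ + |K|) * ‖E‖ := b1
    _ ≤ 2 * (2 * ‖A‖ + |K|) * (|K| * ((6 / c) ^ (2 * d) * ((1 + ‖x‖) ^ (2 * d))⁻¹)) := by
      gcongr
      exact h3.trans (by gcongr)
    _ = _ := by rw [hC]; ring

end AlmostLocal

/-! ### Consequences of the unitary implementation of the space-time translations. -/

section Implementation

variable {d ℓ : ℕ} {H : Type*} [NormedAddCommGroup H] [InnerProductSpace ℂ H] [CompleteSpace H]
  {Φ : Interaction d ℓ} {π : Observable d ℓ →⋆ₐ[ℂ] (H →L[ℂ] H)} {Ω : H}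
  {U : ℝ × SpinLattice d → unitary (H →L[ℂ] H)}

theorem IsImplementation.map_zero (hU : IsImplementation Φ π Ω U) : U 0 = 1 := by
  have := hU.map_add 0 0
  rw [add_zero] at this
  exact (mul_eq_left.1 this.symm)

theorem IsImplementation.star_eq (hU : IsImplementation Φ π Ω U) (g : ℝ × SpinLattice d) :
    star (U g : H →L[ℂ] H) = U (-g) := by
  have h : U g * U (-g) = 1 := by rw [← hU.map_add, add_neg_cancel, hU.map_zero]
  have : star (U g) = U (-g) := by
    rw [Unitary.star_eq_inv]
    exact inv_eq_of_mul_eq_one_right h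
  rw [← this]
  rfl

theorem IsImplementation.apply_add (hU : IsImplementation Φ π Ω U) (g h : ℝ × SpinLattice d)
    (ψ : H) : (U (g + h) : H →L[ℂ] H) ψ = (U g : H →L[ℂ] H) ((U h : H →L[ℂ] H) ψ) := by
  rw [hU.map_add]
  rfl

theorem norm_unitary_apply (u : unitary (H →L[ℂ] H)) (ψ : H) : ‖(u : H →L[ℂ] H) ψ‖ = ‖ψ‖ :=
  ContinuousLinearMap.norm_map_of_mem_unitary u.2 ψ

/-- The bound is read off from the unitaries and the faithfulness of `π`, not from the limit that
defines the dynamics. -/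
theorem norm_spacetime_le [Nontrivial H] (hU : IsImplementation Φ π Ω U) (g : ℝ × SpinLattice d)
    (A : Observable d ℓ) : ‖Φ.spacetime g A‖ ≤ ‖A‖ := by
  rw [← norm_representation π, ← norm_representation π A, hU.implements, hU.star_eq]
  refine ContinuousLinearMap.opNorm_le_bound _ (norm_nonneg _) fun ψ => ?_
  rw [mul_apply_eq_comp, mul_apply_eq_comp, norm_unitary_apply]
  exact (ContinuousLinearMap.le_opNorm _ _).trans (by rw [norm_unitary_apply])

/-- The joint continuity of `(g, ψ) ↦ U(g) ψ`. -/
theorem IsImplementation.continuous_apply (hU : IsImplementation Φ π Ω U) {X : Type*}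
    [TopologicalSpace X] {a : X → ℝ × SpinLattice d} {b : X → H} (ha : Continuous a)
    (hb : Continuous b) : Continuous fun x => (U (a x) : H →L[ℂ] H) (b x) := by
  rw [continuous_iff_continuousAt]
  intro x₀
  have h1 : Tendsto (fun x => (U (a x) : H →L[ℂ] H) (b x₀)) (𝓝 x₀)
      (𝓝 ((U (a x₀) : H →L[ℂ] H) (b x₀))) := ((hU.continuous (b x₀)).comp ha).tendsto x₀
  have h2 : Tendsto (fun x => (U (a x) : H →L[ℂ] H) (b x - b x₀)) (𝓝 x₀) (𝓝 0) := by
    rw [tendsto_zero_iff_norm_tendsto_zero]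
    simp only [norm_unitary_apply]
    have := ((hb.sub (continuous_const (y := b x₀))).norm).tendsto x₀
    simpa using this
  have h3 := h1.add h2
  rw [add_zero] at h3
  refine h3.congr fun x => ?_
  rw [map_sub]
  abel

/-- The orbits `g ↦ τ_g(A)` are measurable: the matrix elements are continuous, and they separate
the points of the separable algebra `𝔄`. -/
theorem stronglyMeasurable_spacetime [Nontrivial H] (hU : IsImplementation Φ π Ω U)
    (hcyc : Dense (Set.range fun A => π A Ω)) (A : Observable d ℓ) :
    StronglyMeasurable fun g => Φ.spacetime g A := by
  have hsep : TopologicalSpace.SeparableSpace H := by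
    have hc : Continuous fun A => π A Ω := (representation_continuous π).clm_apply continuous_const
    exact DenseRange.separableSpace hcyc hc
  have : SecondCountableTopology (Observable d ℓ) := UniformSpace.secondCountable_of_separable _
  borelize (Observable d ℓ)
  let e := TopologicalSpace.denseSeq H
  have he : DenseRange e := TopologicalSpace.denseRange_denseSeq H
  let Ψ : Observable d ℓ → (ℕ × ℕ → ℂ) := fun B mn => ⟪e mn.1, π B (e mn.2)⟫_ℂ
  have hΨc : Continuous Ψ := continuous_pi fun mn =>
    continuous_const.inner ((representation_continuous π).clm_apply continuous_const)
  have hΨi : Function.Injective Ψ := by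
    intro B C h
    have h1 : ∀ m n, ⟪e m, π B (e n)⟫_ℂ = ⟪e m, π C (e n)⟫_ℂ := fun m n => congrFun h (m, n)
    have h2 : ∀ n, π B (e n) = π C (e n) := fun n => by
      refine ext_inner_left ℂ fun v => ?_
      refine congrFun (Continuous.ext_on he (f := fun v => ⟪v, π B (e n)⟫_ℂ)
        (g := fun v => ⟪v, π C (e n)⟫_ℂ) (by fun_prop) (by fun_prop) ?_) v
      rintro _ ⟨m, rfl⟩
      exact h1 m n
    have h3 : π B = π C := by
      refine ContinuousLinearMap.ext fun v => congrFun (he.equalizer (π B).continuous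
        (π C).continuous ?_) v
      funext n
      exact h2 n
    have h4 : ‖π (B - C)‖ = 0 := by rw [map_sub, h3, sub_self, norm_zero]
    rw [norm_representation, norm_eq_zero, sub_eq_zero] at h4
    exact h4
  -- By Lusin-Souslin a continuous injection of a Polish space is a measurable embedding, so
  -- measurability of the matrix elements is enough.
  have hme := hΨc.measurableEmbedding hΨi
  refine Measurable.stronglyMeasurable ?_
  rw [← hme.measurable_comp_iff]
  refine Continuous.measurable (continuous_pi fun mn => ?_)
  change Continuous fun g => ⟪e mn.1, π (Φ.spacetime g A) (e mn.2)⟫_ℂ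
  simp only [hU.implements, hU.star_eq, mul_apply_eq_comp]
  exact continuous_const.inner (hU.continuous_apply continuous_id
    ((π A).continuous.comp (hU.continuous_apply continuous_neg continuous_const)))

theorem integrable_smul_spacetime [Nontrivial H] (hU : IsImplementation Φ π Ω U)
    (hcyc : Dense (Set.range fun A => π A Ω)) (A : Observable d ℓ) {f : ℝ × SpinLattice d → ℂ}
    (hf : Integrable f (haar d)) : Integrable (fun g => f g • Φ.spacetime g A) (haar d) :=
  hf.smul_bdd ‖A‖ (stronglyMeasurable_spacetime hU hcyc A).aestronglyMeasurable
    (Eventually.of_forall fun g => norm_spacetime_le hU g A)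

theorem smear_sum [Nontrivial H] (hU : IsImplementation Φ π Ω U)
    (hcyc : Dense (Set.range fun A => π A Ω)) (A : Observable d ℓ) {ι : Type*} (s : Finset ι)
    {f : ι → ℝ × SpinLattice d → ℂ} (hf : ∀ i ∈ s, Integrable (f i) (haar d)) :
    smear Φ (fun g => ∑ i ∈ s, f i g) A = ∑ i ∈ s, smear Φ (f i) A := by
  simp only [smear, Finset.sum_smul]
  exact integral_finsetSum s fun i hi => integrable_smul_spacetime hU hcyc A (hf i hi)

/-- The bounded linear map `B ↦ π(B) ψ` passes through the Bochner integral, which turns statements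
on `τ_f(A)` into statements on vectors. -/
theorem representation_smear_apply [Nontrivial H] (hU : IsImplementation Φ π Ω U)
    (hcyc : Dense (Set.range fun A => π A Ω)) (A : Observable d ℓ) {f : ℝ × SpinLattice d → ℂ}
    (hf : Integrable f (haar d)) (ψ : H) :
    π (smear Φ f A) ψ = ∫ g, f g • (U g : H →L[ℂ] H) (π A ((U (-g) : H →L[ℂ] H) ψ)) ∂(haar d) := by
  let L : Observable d ℓ →L[ℂ] H :=
    (ContinuousLinearMap.apply ℂ H ψ).comp
      { toLinearMap := π.toAlgHom.toLinearMap, cont := representation_continuous π }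
  have h := L.integral_comp_comm (integrable_smul_spacetime hU hcyc A hf)
  change L (smear Φ f A) = _
  rw [smear, ← h]
  refine integral_congr_ae (Eventually.of_forall fun g => ?_)
  change L (f g • Φ.spacetime g A) = _
  rw [map_smul]
  change f g • π (Φ.spacetime g A) ψ = _
  rw [hU.implements, hU.star_eq]
  rfl

/-- The integral of a function supported at the origin of the lattice. -/
theorem integral_haar_single {E : Type*} [NormedAddCommGroup E] [NormedSpace ℝ E]
    [CompleteSpace E] (G : ℝ × SpinLattice d → E) (hG : Integrable G (haar d)) (h0 : ∀ g, g.2 ≠ 0 → G g = 0) :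
    ∫ g, G g ∂(haar d) = ((2 * Real.pi) ^ (-((d : ℝ) + 1) / 2)) • ∫ t, G (t, 0) := by
  have hc : (0 : ℝ) < (2 * Real.pi) ^ (-((d : ℝ) + 1) / 2) := by positivity
  have hG' : Integrable G ((volume : Measure ℝ).prod (Measure.count : Measure (SpinLattice d))) := by
    rw [haar] at hG
    exact (integrable_smul_measure (by simpa using hc) ENNReal.ofReal_ne_top).1 hG
  rw [haar, integral_smul_measure, ENNReal.toReal_ofReal hc.le, integral_prod_symm _ hG']
  congr 1
  have h1 : ∀ x : SpinLattice d, x ≠ 0 → ∫ t, G (t, x) = 0 := fun x hx => by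
    simp [h0 (_, x) hx]
  rw [integral_countable hG'.integral_prod_right, tsum_eq_single 0 fun x hx => by rw [h1 x hx, smul_zero]]
  simp [Measure.real]

end Implementation

end SpinSystem

/-! ### A partition of unity on the torus with absolutely summable Fourier coefficients. -/

section FejerKernel

open Real

/-- The Fourier coefficients `(sin(π n / m) / (π n / m))²` of a triangle function. -/
noncomputable def triangleCoeff (m : ℕ) (n : ℤ) : ℝ :=
  if n = 0 then 1 else m ^ 2 / π ^ 2 * (1 / (n : ℝ) ^ 2 * sin (π * n / m) ^ 2)

theorem summable_triangleCoeff (m : ℕ) : Summable fun n : ℤ => ‖triangleCoeff m n‖ := by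
  have hs : Summable fun n : ℤ => m ^ 2 / π ^ 2 * (1 / (n : ℝ) ^ 2) :=
    (Real.summable_one_div_int_pow.2 (by norm_num)).mul_left _
  refine Summable.of_norm_bounded_eventually hs ?_
  filter_upwards [(Set.finite_singleton (0 : ℤ)).eventually_cofinite_notMem] with n hn
  rw [Set.mem_singleton_iff] at hn
  rw [triangleCoeff, if_neg hn, norm_norm, norm_of_nonneg (by positivity)]
  gcongr
  exact mul_le_of_le_one_right (by positivity) (sin_sq_le_one _)

theorem triangleCoeff_of_dvd {m : ℕ} (hm : 0 < m) {n : ℤ} (hn : n ≠ 0) (h : (m : ℤ) ∣ n) :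
    triangleCoeff m n = 0 := by
  obtain ⟨k, rfl⟩ := h
  have hm' : (m : ℝ) ≠ 0 := by positivity
  have : π * ((m * k : ℤ) : ℝ) / m = k * π := by
    push_cast
    field_simp
  rw [triangleCoeff, if_neg hn, this, sin_int_mul_pi]
  ring

/-- This is the Fourier series of the second Bernoulli polynomial; the triangle function arises as
its second difference. -/
theorem hasSum_cos_div_sq {x : ℝ} (hx : x ∈ Set.Icc (0 : ℝ) 1) :
    HasSum (fun n : ℕ => 1 / (n : ℝ) ^ 2 * cos (2 * π * n * x)) (π ^ 2 * (x ^ 2 - x + 1 / 6)) := by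
  have h := hasSum_one_div_nat_pow_mul_cos one_ne_zero hx
  have e : (Polynomial.map (algebraMap ℚ ℝ) (Polynomial.bernoulli 2)).eval x = x ^ 2 - x + 1 / 6 := by
    have h2 : bernoulli 2 = 1 / 6 := by simp [bernoulli]
    simp only [Polynomial.bernoulli, Finset.sum_range_succ, Finset.sum_range_zero, h2,
      bernoulli_zero, bernoulli_one]
    norm_num [Nat.choose]
    ring
  rw [mul_one, e] at h
  convert! h using 1
  simp only [Nat.factorial]
  push_cast
  ring

/-- The Fourier series of a triangle function vanishes outside its support. -/
theorem tsum_triangleCoeff_cos {m : ℕ} (hm : 2 ≤ m) {y : ℝ}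
    (hy : y ∈ Set.Icc (1 / (m : ℝ)) (1 - 1 / m)) :
    HasSum (fun n : ℕ => 2 * triangleCoeff m (n + 1) * cos (2 * π * (n + 1) * y)) (-1) := by
  have hm0 : (0 : ℝ) < m := by positivity
  have hm1 : 0 < 1 / (m : ℝ) := by positivity
  have h0 := hasSum_cos_div_sq (x := y) ⟨by linarith [hy.1], by linarith [hy.2]⟩
  -- The assumption on `y` keeps `y ± 1/m` in `[0, 1]`, where the series equals a single quadratic
  -- polynomial. Its second difference is then constant, which yields the value `-1` after
  -- rescaling.
  have h1 := hasSum_cos_div_sq (x := y + 1 / m) ⟨by linarith [hy.1], by linarith [hy.2]⟩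
  -- The term `n = 0`, removed below, vanishes because `1 / 0 = 0`.
  have h2 := hasSum_cos_div_sq (x := y - 1 / m) ⟨by linarith [hy.1], by linarith [hy.2]⟩
  have h3 := ((h0.sub ((h1.add h2).div_const 2)).mul_left ((m : ℝ) ^ 2 / π ^ 2))
  have h4 := (hasSum_nat_add_iff' 1).2 h3
  convert! h4 using 1
  · funext n
    have hn : ((n : ℤ) + 1) ≠ 0 := by positivity
    rw [triangleCoeff, if_neg hn]
    push_cast
    have e1 : sin (π * (n + 1) / m) ^ 2 = (1 - cos (2 * π * (n + 1) * (1 / m))) / 2 := by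
      have : 2 * π * (n + 1) * (1 / m) = 2 * (π * (n + 1) / m) := by ring
      rw [this, cos_two_mul, cos_sq']
      ring
    have e2 : cos (2 * π * (n + 1) * (y + 1 / m)) + cos (2 * π * (n + 1) * (y - 1 / m)) =
        2 * cos (2 * π * (n + 1) * y) * cos (2 * π * (n + 1) * (1 / m)) := by
      rw [mul_add, mul_sub, cos_add, cos_sub]
      ring
    rw [e1]
    have e3 : ∀ a : ℝ, a * cos (2 * π * (n + 1) * (y + 1 / m)) +
        a * cos (2 * π * (n + 1) * (y - 1 / m)) =
        a * (2 * cos (2 * π * (n + 1) * y) * cos (2 * π * (n + 1) * (1 / m))) := fun a => by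
      rw [← e2]; ring
    rw [e3]
    ring
  · simp
    field_simp
    ring

theorem toCircle_zsmul_coe (n : ℤ) (x : ℝ) :
    (AddCircle.toCircle (n • (x : AddCircle (2 * π))) : ℂ) = Complex.exp (Complex.I * (n * x)) := by
  rw [← AddCircle.coe_zsmul, AddCircle.toCircle_apply_mk, Circle.coe_exp]
  congr 1
  have : (π : ℂ) ≠ 0 := by exact_mod_cast pi_ne_zero
  simp only [zsmul_eq_mul]
  push_cast
  field_simp

theorem summable_triangleCoeff_mul_circle (m : ℕ) (c : ℤ → Circle) :
    Summable fun n : ℤ => (c n : ℂ) * triangleCoeff m n := by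
  refine Summable.of_norm ((summable_triangleCoeff m).congr fun n => ?_)
  rw [norm_mul, Circle.norm_coe, one_mul, Complex.norm_real]

/-- With the representative `x = 2πy` in `[0, 2π)` the distance condition becomes `1/m ≤ y ≤ 1 -
1/m`, and pairing `n` with `-n` reduces the sum to the cosine series. -/
theorem tsum_toCircle_triangleCoeff {m : ℕ} (hm : 2 ≤ m) {p : AddCircle (2 * π)}
    (hp : 2 * π / m ≤ ‖p‖) :
    ∑' n : ℤ, (AddCircle.toCircle (-(n • p)) : ℂ) * triangleCoeff m n = 0 := by
  have hπ : 0 < 2 * π := by positivity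
  have : Fact (0 < 2 * π) := ⟨hπ⟩
  obtain ⟨x, hx, rfl⟩ : ∃ x ∈ Set.Ico 0 (0 + 2 * π), (x : AddCircle (2 * π)) = p := by
    have : p ∈ ((↑) : ℝ → AddCircle (2 * π)) '' Set.Ico 0 (0 + 2 * π) := by
      rw [AddCircle.coe_image_Ico_eq]
      trivial
    exact this
  have hn1 : ‖(x : AddCircle (2 * π))‖ ≤ x := by
    refine (QuotientAddGroup.norm_mk_le_norm).trans ?_
    rw [norm_of_nonneg hx.1]
  have hn2 : ‖(x : AddCircle (2 * π))‖ ≤ 2 * π - x := by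
    have : (x : AddCircle (2 * π)) = ((x - 2 * π : ℝ) : AddCircle (2 * π)) := by
      rw [AddCircle.coe_sub, AddCircle.coe_period, sub_zero]
    rw [this]
    refine (QuotientAddGroup.norm_mk_le_norm).trans ?_
    rw [norm_of_nonpos (by linarith [hx.2])]
    linarith
  set y := x / (2 * π) with hy
  have hxy : x = 2 * π * y := by rw [hy]; field_simp
  have hm0 : (0 : ℝ) < m := by positivity
  have hy' : y ∈ Set.Icc (1 / (m : ℝ)) (1 - 1 / m) := by
    have e : 2 * π / m = 2 * π * (1 / m) := by ring
    constructor
    · refine le_of_mul_le_mul_left ?_ hπ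
      linarith
    · refine le_of_mul_le_mul_left ?_ hπ
      linarith
  have hs := summable_triangleCoeff_mul_circle m fun n => AddCircle.toCircle (-(n • (x : AddCircle (2 * π))))
  set f : ℤ → ℂ := fun n => (AddCircle.toCircle (-(n • (x : AddCircle (2 * π)))) : ℂ) *
    triangleCoeff m n with hf
  have hf' : ∀ n : ℤ, f n = Complex.exp (Complex.I * ((-n : ℤ) * x)) * triangleCoeff m n := fun n => by
    rw [hf, ← toCircle_zsmul_coe, neg_smul]
  -- Pairing counts the term `n = 0` twice; dropping that pair leaves the full sum minus `f 0 = 1`.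
  have h1 := (hasSum_nat_add_iff' 1).2 hs.hasSum.nat_add_neg
  have h2 := (Complex.hasSum_ofReal.2 (tsum_triangleCoeff_cos hm hy'))
  have e0 : f 0 = 1 := by rw [hf']; simp [triangleCoeff]
  have he : (fun n : ℕ => f ((n + 1 : ℕ) : ℤ) + f (-((n + 1 : ℕ) : ℤ))) = fun n : ℕ =>
      ((2 * triangleCoeff m (n + 1) * cos (2 * π * (n + 1) * y) : ℝ) : ℂ) := by
    funext n
    have ek : triangleCoeff m (-((n : ℤ) + 1)) = triangleCoeff m ((n : ℤ) + 1) := by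
      have hn : ((n : ℤ) + 1) ≠ 0 := by positivity
      have hn' : (-((n : ℤ) + 1)) ≠ 0 := neg_ne_zero.2 hn
      rw [triangleCoeff, if_neg hn', triangleCoeff, if_neg hn]
      push_cast
      rw [neg_sq, mul_neg, neg_div, sin_neg, neg_sq]
    have ec : Complex.cos (2 * π * (n + 1) * y) =
        (Complex.exp (Complex.I * ((n + 1) * x)) + Complex.exp (-(Complex.I * ((n + 1) * x)))) / 2 := by
      rw [Complex.cos, hxy]
      push_cast
      congr 2 <;> congr 1 <;> ring
    rw [hf', hf']
    push_cast
    rw [ek, ec]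
    have a2 : Complex.I * (-((n : ℂ) + 1) * x) = -(Complex.I * ((n + 1) * x)) := by ring
    have a3 : Complex.I * ((- -((n : ℂ) + 1)) * x) = Complex.I * ((n + 1) * x) := by ring
    simp only [a2, a3]
    ring
  rw [he] at h1
  have := h1.unique h2
  rw [Finset.sum_range_one] at this
  push_cast at this
  rw [neg_zero, e0] at this
  linear_combination this

/-- The translates of the triangle function, on the side of the lattice. -/
noncomputable def modulatedTriangle (m : ℕ) (q : Fin m) (n : ℤ) : ℂ :=
  (m : ℂ)⁻¹ * ((AddCircle.toCircle (n • ((2 * π * (q / m) : ℝ) : AddCircle (2 * π))) : ℂ) *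
    triangleCoeff m n)

theorem summable_modulatedTriangle (m : ℕ) (q : Fin m) :
    Summable fun n : ℤ => ‖modulatedTriangle m q n‖ := by
  refine ((summable_triangleCoeff m).mul_left ‖(m : ℂ)⁻¹‖).congr fun n => ?_
  rw [modulatedTriangle, norm_mul, norm_mul, Circle.norm_coe, one_mul, Complex.norm_real]

/-- The `m` translates of the triangle sum to the constant `1`: the sum of the roots of unity kills
the coefficients with `m ∤ n`, and those with `m ∣ n`, `n ≠ 0`, vanish already. -/
theorem sum_modulatedTriangle {m : ℕ} (hm : 0 < m) (n : ℤ) :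
    ∑ q, modulatedTriangle m q n = if n = 0 then 1 else 0 := by
  have hm0 : (m : ℂ) ≠ 0 := by positivity
  simp only [modulatedTriangle, ← Finset.mul_sum, ← Finset.sum_mul]
  split_ifs with hn
  · subst hn
    simp [triangleCoeff, hm0]
  · by_cases hd : (m : ℤ) ∣ n
    · rw [triangleCoeff_of_dvd hm hn hd]
      simp
    · set ζ : ℂ := Complex.exp (2 * π * Complex.I * (n / m)) with hζ
      have e : ∀ q : Fin m, (AddCircle.toCircle (n • ((2 * π * (q / m) : ℝ) : AddCircle (2 * π))) : ℂ) =
          ζ ^ (q : ℕ) := fun q => by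
        rw [toCircle_zsmul_coe, hζ, ← Complex.exp_nat_mul]
        congr 1
        push_cast
        ring
      have hζ1 : ζ ≠ 1 := by
        rw [hζ, Ne, Complex.exp_eq_one_iff]
        rintro ⟨k, hk⟩
        refine hd ⟨k, ?_⟩
        have h2 : (2 * π * Complex.I) ≠ 0 := Complex.two_pi_I_ne_zero
        have h3 : (n : ℂ) / m = k := mul_left_cancel₀ h2 (by rw [hk]; ring)
        rw [div_eq_iff hm0] at h3
        have : (n : ℂ) = ((m * k : ℤ) : ℂ) := by rw [h3]; push_cast; ring
        exact_mod_cast this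
      have hζm : ζ ^ m = 1 := by
        rw [hζ, ← Complex.exp_nat_mul, Complex.exp_eq_one_iff]
        exact ⟨n, by field_simp⟩
      have hsum : ∑ q : Fin m, ζ ^ (q : ℕ) = 0 := by
        rw [Fin.sum_univ_eq_sum_range (fun i => ζ ^ i), geom_sum_eq hζ1, hζm, sub_self, zero_div]
      simp only [e]
      rw [hsum]
      simp

/-- Modulating the coefficients translates the function on the circle. -/
theorem tsum_modulatedTriangle {m : ℕ} (hm : 2 ≤ m) (q : Fin m) {p : AddCircle (2 * π)}
    (hp : 2 * π / m ≤ dist p ((2 * π * (q / m) : ℝ) : AddCircle (2 * π))) :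
    ∑' n : ℤ, (AddCircle.toCircle (-(n • p)) : ℂ) * modulatedTriangle m q n = 0 := by
  rw [dist_eq_norm] at hp
  have h := tsum_toCircle_triangleCoeff hm hp
  rw [← mul_zero (m : ℂ)⁻¹, ← h, ← tsum_mul_left]
  refine tsum_congr fun n => ?_
  rw [modulatedTriangle, smul_sub, neg_sub, sub_eq_add_neg, AddCircle.toCircle_add, Circle.coe_mul]
  ring

theorem coe_toCircle_sum {T : ℝ} {ι : Type*} (s : Finset ι) (p : ι → AddCircle T) :
    (AddCircle.toCircle (∑ i ∈ s, p i) : ℂ) = ∏ i ∈ s, (AddCircle.toCircle (p i) : ℂ) := by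
  classical
  induction s using Finset.induction_on with
  | empty => simp
  | insert i s hi ih =>
    rw [Finset.sum_insert hi, Finset.prod_insert hi, AddCircle.toCircle_add, Circle.coe_mul, ih]

/-- A partition of unity on the torus into functions of small support which have summable Fourier
coefficients `κ q`. -/
theorem exists_lattice_partition (d : ℕ) {r : ℝ} (hr : 0 < r) :
    ∃ (ι : Type) (_ : Fintype ι) (κ : ι → (Fin d → ℤ) → ℂ) (θ : ι → Fin d → AddCircle (2 * π)),
      (∀ q, Summable fun x => ‖κ q x‖) ∧ (∀ x, ∑ q, κ q x = if x = 0 then 1 else 0) ∧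
      ∀ q p, ∑' x : Fin d → ℤ, (AddCircle.toCircle (-∑ i, x i • p i) : ℂ) * κ q x ≠ 0 →
        dist p (θ q) ≤ r := by
  obtain ⟨m, hm⟩ := exists_nat_gt (max 2 (2 * π / r))
  have hm2 : 2 ≤ m := by exact_mod_cast ((le_max_left _ _).trans hm.le)
  have hm0 : (0 : ℝ) < m := by positivity
  have hmr : 2 * π / m ≤ r := by
    have := (le_max_right _ _).trans hm.le
    rw [div_le_iff₀ hr] at this
    rw [div_le_iff₀ hm0]
    linarith
  refine ⟨Fin d → Fin m, inferInstance, fun q x => ∏ i, modulatedTriangle m (q i) (x i),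
    fun q i => ((2 * π * (q i / m) : ℝ) : AddCircle (2 * π)), fun q => ?_, fun x => ?_, fun q p h => ?_⟩
  · exact (summable_norm_and_tsum_pi_prod d (fun i => modulatedTriangle m (q i))
      fun i => summable_modulatedTriangle m (q i)).1
  · have h := Finset.prod_univ_sum (fun _ : Fin d => (Finset.univ : Finset (Fin m)))
      (fun i q => modulatedTriangle m q (x i))
    rw [Fintype.piFinset_univ] at h
    rw [← h]
    simp only [sum_modulatedTriangle (by lia : 0 < m)]
    by_cases hx : x = 0
    · simp [hx]
    · obtain ⟨i, hi⟩ := Function.ne_iff.1 hx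
      rw [if_neg hx]
      exact Finset.prod_eq_zero (Finset.mem_univ i) (if_neg hi)
  -- The series factorises over the coordinates, so one coordinate of `p` far from its centre makes
  -- it vanish.
  · rw [dist_pi_le_iff hr.le]
    intro i
    by_contra hi
    push Not at hi
    refine h ?_
    have e : ∀ x : Fin d → ℤ, (AddCircle.toCircle (-∑ i, x i • p i) : ℂ) *
        ∏ i, modulatedTriangle m (q i) (x i) =
        ∏ i, (AddCircle.toCircle (-(x i • p i)) : ℂ) * modulatedTriangle m (q i) (x i) := fun x => by
      rw [Finset.prod_mul_distrib, ← Finset.sum_neg_distrib]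
      rw [coe_toCircle_sum]
    simp only [e]
    rw [(summable_norm_and_tsum_pi_prod d (fun i n => (AddCircle.toCircle (-(n • p i)) : ℂ) *
      modulatedTriangle m (q i) n) fun i => ?_).2]
    · exact Finset.prod_eq_zero (Finset.mem_univ i) (tsum_modulatedTriangle hm2 (q i) (hmr.trans hi.le))
    · refine (summable_modulatedTriangle m (q i)).congr fun n => ?_
      rw [norm_mul, Circle.norm_coe, one_mul]

end FejerKernel

/-! ### Fourier analysis in the time variable. -/

section TimeFourier

open scoped FourierTransform SchwartzMap ContDiff
open Real

/-- The Fourier transform `∫ e^{i E t} f(t) dt`. -/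
noncomputable def timeFourier (f : ℝ → ℂ) (E : ℝ) : ℂ :=
  ∫ t, Complex.exp (Complex.I * (E * t : ℝ)) * f t

theorem norm_exp_I_mul (x : ℝ) : ‖Complex.exp (Complex.I * x)‖ = 1 := by
  rw [mul_comm, Complex.norm_exp_ofReal_mul_I]

theorem timeFourier_eq (f : ℝ → ℂ) (E : ℝ) : timeFourier f E = 𝓕 f (-(E / (2 * π))) := by
  rw [Real.fourier_real_eq_integral_exp_smul, timeFourier]
  congr 1
  funext t
  rw [smul_eq_mul]
  congr 2
  have : -2 * π * t * -(E / (2 * π)) = E * t := by field_simp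
  rw [this, mul_comm]

theorem fourier_eq_timeFourier (f : ℝ → ℂ) (w : ℝ) : 𝓕 f w = timeFourier f (-(2 * π * w)) := by
  rw [timeFourier_eq]
  field_simp

theorem timeFourier_continuous (f : 𝓢(ℝ, ℂ)) : Continuous (timeFourier f) := by
  have : timeFourier f = fun E => (𝓕 f) (-(E / (2 * π))) := by
    funext E
    rw [timeFourier_eq, SchwartzMap.fourier_coe]
  rw [this]
  exact (𝓕 f).continuous.comp (by fun_prop)

theorem norm_timeFourier_le (f : ℝ → ℂ) (E : ℝ) : ‖timeFourier f E‖ ≤ ∫ t, ‖f t‖ := by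
  refine (norm_integral_le_integral_norm _).trans_eq (integral_congr_ae (Eventually.of_forall fun t => ?_))
  change ‖_ * _‖ = _
  rw [norm_mul, norm_exp_I_mul, one_mul]

theorem timeFourier_injective {f g : 𝓢(ℝ, ℂ)} (h : ∀ E, timeFourier f E = timeFourier g E) :
    f = g := by
  have : 𝓕 f = 𝓕 g := by
    ext w
    rw [SchwartzMap.fourier_coe, SchwartzMap.fourier_coe, fourier_eq_timeFourier,
      fourier_eq_timeFourier, h]
  have h1 : 𝓕⁻ (𝓕 f) = f := FourierTransform.fourierInv_fourier_eq f
  have h2 : 𝓕⁻ (𝓕 g) = g := FourierTransform.fourierInv_fourier_eq g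
  rw [← h1, this, h2]

/-- Fourier inversion, after the substitution `E = -2πw` between the two conventions for the
transform; it lets energy cutoffs be prescribed freely. -/
theorem exists_timeFourier_eq {η : ℝ → ℂ} (hη : ContDiff ℝ ∞ η) (hc : HasCompactSupport η) :
    ∃ h : 𝓢(ℝ, ℂ), ∀ E, timeFourier h E = η E := by
  let e : ℝ ≃ₜ ℝ := (Homeomorph.mulLeft₀ (-(2 * π)) (by simp [pi_ne_zero]))
  have hc' : HasCompactSupport (fun w => η (-(2 * π) * w)) := hc.comp_homeomorph e
  have hη' : ContDiff ℝ ∞ (fun w => η (-(2 * π) * w)) := hη.comp (by fun_prop)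
  refine ⟨𝓕⁻ (hc'.toSchwartzMap hη'), fun E => ?_⟩
  rw [timeFourier_eq, ← SchwartzMap.fourier_coe, FourierTransform.fourier_fourierInv_eq]
  change η (-(2 * π) * -(E / (2 * π))) = η E
  congr 1
  field_simp

/-- The Fourier transform of `s ↦ k(s) h(u - s)` is a superposition of translates of the Fourier
transform of `k`. -/
theorem exists_mul_reflect (k h : 𝓢(ℝ, ℂ)) (u : ℝ) :
    ∃ g : 𝓢(ℝ, ℂ), (∀ s, g s = k s * h (u - s)) ∧
      ∀ E, timeFourier g E ≠ 0 → ∃ E', timeFourier h E' ≠ 0 ∧ timeFourier k (E + E') ≠ 0 := by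
  have hh : Function.HasTemperateGrowth fun s : ℝ => h (u - s) :=
    h.hasTemperateGrowth.comp (by fun_prop)
  have hg : ∀ s, SchwartzMap.smulLeftCLM ℂ (fun s => h (u - s)) k s = k s * h (u - s) := fun s => by
    rw [SchwartzMap.smulLeftCLM_apply_apply hh, smul_eq_mul, mul_comm]
  refine ⟨SchwartzMap.smulLeftCLM ℂ (fun s => h (u - s)) k, hg, fun E hE => ?_⟩
  by_contra hcon
  push Not at hcon
  refine hE ?_
  have hinv : ∀ t, h t = ∫ w : ℝ, Complex.exp (Complex.I * (2 * π * w * t : ℝ)) * (𝓕 h) w := fun t => by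
    have h1 : h = 𝓕⁻ (𝓕 h) := (FourierTransform.fourierInv_fourier_eq h).symm
    conv_lhs => rw [h1]
    rw [SchwartzMap.fourierInv_coe, Real.fourierInv_eq']
    refine integral_congr_ae (Eventually.of_forall fun w => ?_)
    change _ • _ = _
    rw [smul_eq_mul]
    congr 2
    rw [mul_comm]
    congr 2
    simp
    ring
  have e1 : timeFourier (SchwartzMap.smulLeftCLM ℂ (fun s => h (u - s)) k) E =
      ∫ s : ℝ, ∫ w : ℝ, Complex.exp (Complex.I * (E * s : ℝ)) * (k s *
        (Complex.exp (Complex.I * (2 * π * w * (u - s) : ℝ)) * (𝓕 h) w)) := by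
    rw [timeFourier]
    refine integral_congr_ae (Eventually.of_forall fun s => ?_)
    change _ * _ = _
    rw [hg, hinv (u - s), ← integral_const_mul, ← integral_const_mul]
  rw [e1, integral_integral_swap]
  · rw [← integral_zero ℝ ℂ]
    refine integral_congr_ae (Eventually.of_forall fun w => ?_)
    change (∫ s : ℝ, _) = 0
    -- At frequency `w` the factor `h(u - s)` shifts the energy of `k` by `E' = -2πw`, so the inner
    -- integral is the transform of `k` at `E + E'`.
    have e2 : ∀ s : ℝ, Complex.exp (Complex.I * (E * s : ℝ)) * (k s *
        (Complex.exp (Complex.I * (2 * π * w * (u - s) : ℝ)) * (𝓕 h) w)) =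
        (Complex.exp (Complex.I * (2 * π * w * u : ℝ)) * (𝓕 h) w) *
          (Complex.exp (Complex.I * ((E + -(2 * π * w)) * s : ℝ)) * k s) := fun s => by
      have : Complex.exp (Complex.I * (E * s : ℝ)) *
          Complex.exp (Complex.I * (2 * π * w * (u - s) : ℝ)) =
          Complex.exp (Complex.I * (2 * π * w * u : ℝ)) *
          Complex.exp (Complex.I * ((E + -(2 * π * w)) * s : ℝ)) := by
        rw [← Complex.exp_add, ← Complex.exp_add]
        congr 1
        push_cast
        ring
      linear_combination (k s * (𝓕 h) w) * this
    simp only [e2]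
    rw [integral_const_mul]
    change _ * timeFourier k _ = 0
    by_cases hw : timeFourier h (-(2 * π * w)) = 0
    · rw [SchwartzMap.fourier_coe, fourier_eq_timeFourier, hw]
      simp
    · rw [hcon _ hw, mul_zero]
  · have hi : Integrable (fun p : ℝ × ℝ => k p.1 * (𝓕 h) p.2) (volume.prod volume) :=
      k.integrable.mul_prod (𝓕 h).integrable
    refine hi.mono ?_ (Eventually.of_forall fun p => ?_)
    · refine Continuous.aestronglyMeasurable ?_
      have := k.continuous
      have := h.continuous
      have := (𝓕 h).continuous
      simp only [Function.uncurry_def]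
      fun_prop
    · simp only [Function.uncurry_def]
      rw [norm_mul, norm_mul, norm_mul, norm_exp_I_mul, norm_exp_I_mul, one_mul, one_mul, norm_mul]

theorem contDiff_timeFourier (f : 𝓢(ℝ, ℂ)) : ContDiff ℝ ∞ (timeFourier f) := by
  have : timeFourier f = fun E => (𝓕 f) (-(E / (2 * π))) := by
    funext E
    rw [timeFourier_eq, SchwartzMap.fourier_coe]
  rw [this]
  exact ((𝓕 f).smooth ⊤).comp (by fun_prop)

/-- A decomposition of a band-limited Schwartz function into functions with small bands. -/
theorem exists_time_partition (f : 𝓢(ℝ, ℂ)) {M : Set ℝ} (hM : IsCompact M)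
    (hf : ∀ E, timeFourier f E ≠ 0 → E ∈ M) {r : ℝ} (hr : 0 < r) :
    ∃ (J : Finset ℤ) (F : ℤ → 𝓢(ℝ, ℂ)) (c : ℤ → ℝ), (∀ t, ∑ j ∈ J, F j t = f t) ∧
      ∀ j E, timeFourier (F j) E ≠ 0 → E ∈ M ∧ dist E (c j) ≤ r := by
  -- Differences of consecutive smooth steps: each is supported in `[jr, (j+2)r]`, and their sum
  -- telescopes.
  let ρ : ℤ → ℝ → ℝ := fun j E => smoothTransition (E / r - j) - smoothTransition (E / r - (j + 1))
  have hρ : ∀ j E, ρ j E ≠ 0 → dist E ((j + 1) * r) ≤ r := by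
    intro j E h
    rw [Real.dist_eq, abs_le]
    constructor
    · by_contra hlt
      push Not at hlt
      have : E / r < j := by
        rw [div_lt_iff₀ hr]; linarith
      exact h (by simp only [ρ]; rw [smoothTransition.zero_of_nonpos (by linarith),
        smoothTransition.zero_of_nonpos (by linarith), sub_zero])
    · by_contra hlt
      push Not at hlt
      have : (j : ℝ) + 2 < E / r := by
        rw [lt_div_iff₀ hr]; linarith
      exact h (by simp only [ρ]; rw [smoothTransition.one_of_one_le (by linarith),
        smoothTransition.one_of_one_le (by linarith), sub_self])
  have hρs : ∀ j, ContDiff ℝ ∞ (ρ j) := fun j =>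
    (smoothTransition.contDiff.comp (by fun_prop)).sub (smoothTransition.contDiff.comp (by fun_prop))
  have hρc : ∀ j, HasCompactSupport (fun E => (ρ j E : ℂ) * timeFourier f E) := fun j => by
    refine HasCompactSupport.intro (isCompact_closedBall (((j : ℝ) + 1) * r) r) fun E hE => ?_
    have : ρ j E = 0 := by
      by_contra h
      exact hE (Metric.mem_closedBall.2 (hρ j E h))
    simp [this]
  have hex : ∀ j, ∃ h : 𝓢(ℝ, ℂ), ∀ E, timeFourier h E = (ρ j E : ℂ) * timeFourier f E := fun j =>
    exists_timeFourier_eq ((Complex.ofRealCLM.contDiff.comp (hρs j)).mul (contDiff_timeFourier f))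
      (hρc j)
  choose F hF using hex
  obtain ⟨R, hR⟩ := hM.isBounded.subset_closedBall 0
  -- The extra `1` places all of `M` where the first step of the telescope is already `1`.
  obtain ⟨n, hn⟩ := exists_nat_gt (R / r + 1)
  refine ⟨Finset.Ico (-n : ℤ) n, F, fun j => (j + 1) * r, fun t => ?_, fun j E h => ?_⟩
  · have htel : ∀ E, E ∈ M → ∑ j ∈ Finset.Ico (-n : ℤ) n, ρ j E = 1 := by
      intro E hE
      have hE' := hR hE
      rw [mem_closedBall_zero_iff, Real.norm_eq_abs, abs_le] at hE'
      have h1 : E / r ≤ R / r := by gcongr; exact hE'.2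
      have h2 : -(R / r) ≤ E / r := by rw [← neg_div]; gcongr; exact hE'.1
      have tel : ∀ N : ℕ, ∑ j ∈ Finset.Ico (-n : ℤ) (-n + N), ρ j E =
          smoothTransition (E / r + n) - smoothTransition (E / r + n - N) := by
        intro N
        induction N with
        | zero => simp
        | succ N ih =>
          rw [Nat.cast_succ, ← add_assoc, ← Finset.insert_Ico_right_eq_Ico_add_one (by lia),
            Finset.sum_insert (by simp), ih]
          simp only [ρ]
          push_cast
          have e1 : E / r - (-n + N) = E / r + n - N := by ring
          have e2 : E / r - (-n + N + 1) = E / r + n - (N + 1) := by ring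
          rw [e1, e2]
          ring
      have := tel (2 * n)
      have e : (-n + ((2 * n : ℕ) : ℤ) : ℤ) = n := by push_cast; ring
      rw [e, smoothTransition.one_of_one_le (by linarith), smoothTransition.zero_of_nonpos
        (by push_cast; linarith), sub_zero] at this
      exact this
    have hsum : (∑ j ∈ Finset.Ico (-n : ℤ) n, F j) = f := by
      refine timeFourier_injective fun E => ?_
      have : timeFourier (∑ j ∈ Finset.Ico (-n : ℤ) n, F j : 𝓢(ℝ, ℂ)) E =
          ∑ j ∈ Finset.Ico (-n : ℤ) n, timeFourier (F j) E := by
        simp only [timeFourier]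
        rw [← integral_finsetSum]
        · refine integral_congr_ae (Eventually.of_forall fun t => ?_)
          simp [Finset.mul_sum]
        · intro j _
          refine (F j).integrable.mono (Continuous.aestronglyMeasurable ?_)
            (Eventually.of_forall fun t => ?_)
          · have := (F j).continuous
            fun_prop
          · rw [norm_mul, norm_exp_I_mul, one_mul]
      rw [this]
      simp only [hF]
      rw [← Finset.sum_mul, ← Complex.ofReal_sum]
      by_cases h : timeFourier f E = 0
      · rw [h, mul_zero]
      · rw [htel E (hf E h), Complex.ofReal_one, one_mul]
    rw [← hsum]
    simp
  · rw [hF] at h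
    refine ⟨hf E (right_ne_zero_of_mul h), hρ j E ?_⟩
    have := left_ne_zero_of_mul h
    exact_mod_cast this

end TimeFourier

namespace SpinSystem

/-! ### From the Arveson spectrum to vanishing smeared observables. -/

section Arveson

open scoped SchwartzMap

variable {d ℓ : ℕ} {H : Type*} [NormedAddCommGroup H] [InnerProductSpace ℂ H] [CompleteSpace H]
  {Φ : Interaction d ℓ} {π : Observable d ℓ →⋆ₐ[ℂ] (H →L[ℂ] H)} {Ω : H}
  {U : ℝ × SpinLattice d → unitary (H →L[ℂ] H)}

theorem integrable_haar_mul {f : ℝ → ℂ} (hf : Integrable f) {κ : SpinLattice d → ℂ}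
    (hκ : Summable fun x => ‖κ x‖) : Integrable (fun g => f g.1 * κ g.2) (haar d) := by
  rw [haar]
  refine Integrable.smul_measure ?_ ENNReal.ofReal_ne_top
  exact hf.mul_prod (integrable_count_iff.2 hκ)

theorem fourier_mul (f : ℝ → ℂ) {κ : SpinLattice d → ℂ} (hκ : Summable fun x => ‖κ x‖) (q : Dual d) :
    fourier (fun g => f g.1 * κ g.2) q =
      ((2 * Real.pi) ^ (-((d : ℝ) + 1) / 2) : ℝ) * (timeFourier f q.1 *
        ∑' x : SpinLattice d, (AddCircle.toCircle (-∑ i, x i • q.2 i) : ℂ) * κ x) := by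
  have hc : (0 : ℝ) < (2 * Real.pi) ^ (-((d : ℝ) + 1) / 2) := by positivity
  have e : ∀ g : ℝ × SpinLattice d, phase q g * (f g.1 * κ g.2) =
      (Complex.exp (Complex.I * (q.1 * g.1 : ℝ)) * f g.1) *
        ((AddCircle.toCircle (-∑ i, g.2 i • q.2 i) : ℂ) * κ g.2) := fun g => by
    rw [phase]
    ring
  rw [fourier, haar, integral_smul_measure, ENNReal.toReal_ofReal hc.le]
  simp only [e]
  rw [integral_prod_mul (fun t : ℝ => Complex.exp (Complex.I * (q.1 * t : ℝ)) * f t)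
    (fun x : SpinLattice d => (AddCircle.toCircle (-∑ i, x i • q.2 i) : ℂ) * κ x)]
  rw [integral_countable (μ := (Measure.count : Measure (SpinLattice d)))]
  · simp only [Measure.real, Measure.count_singleton, ENNReal.toReal_one, one_smul]
    rw [Complex.real_smul]
    rfl
  · refine integrable_count_iff.2 (hκ.congr fun x => ?_)
    rw [norm_mul, Circle.norm_coe, one_mul]

/-- The smearing in time with a function whose energies avoid those of the Arveson spectrum
vanishes. -/
theorem smear_time_eq_zero [Nontrivial H] (hU : IsImplementation Φ π Ω U)
    (hcyc : Dense (Set.range fun A => π A Ω)) {A : Observable d ℓ} {ε : ℝ} (hε : 0 < ε)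
    (hA : arvesonSpectrum Φ A ⊆ Set.Iic (-ε) ×ˢ Set.univ) (f : 𝓢(ℝ, ℂ)) {M : Set ℝ}
    (hM : IsCompact M) (hf : ∀ E, timeFourier f E ≠ 0 → E ∈ M) (hMε : M ⊆ Set.Ioi (-ε)) :
    smear Φ (fun g => f g.1 * if g.2 = 0 then 1 else 0) A = 0 := by
  have : Fact (0 < 2 * Real.pi) := ⟨by positivity⟩
  set 𝒮 : Set (Set (Dual d)) := {S | IsClosed S ∧ ∀ f : ℝ × SpinLattice d → ℂ,
    Integrable f (haar d) → Disjoint (tsupport (fourier f)) S → smear Φ f A = 0} with h𝒮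
  -- The spectrum is an intersection of admissible sets and is not known here to be admissible
  -- itself. Each point outside it is missed by some admissible `S`, so the argument is local and
  -- has to be patched together.
  have hsp : ∀ q : Dual d, -ε < q.1 → ∃ S : 𝒮, q ∉ S.1 := by
    intro q hq
    by_contra hcon
    push Not at hcon
    have : q ∈ arvesonSpectrum Φ A := fun S hS => hcon ⟨S, hS⟩
    exact absurd (hA this).1 (not_le.2 hq)
  have hK : IsCompact (M ×ˢ (Set.univ : Set (Fin d → AddCircle (2 * Real.pi)))) :=
    hM.prod isCompact_univ
  -- Every `δ`-ball centred in this compact set avoids a single admissible set, so pieces with bands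
  -- of radius `δ/3` smear `A` to zero one by one.
  obtain ⟨δ, hδ, hcov⟩ := lebesgue_number_lemma_of_metric hK (c := fun S : 𝒮 => S.1ᶜ)
    (fun S => S.2.1.isOpen_compl) (fun q hq => Set.mem_iUnion.2 (hsp q (hMε hq.1)))
  -- Some admissible set is needed for the pieces whose transform vanishes identically.
  obtain ⟨S₀, -⟩ := hsp 0 (by simpa using hε)
  obtain ⟨J, F, c, hsum, hFc⟩ := exists_time_partition f hM hf (r := δ / 3) (by positivity)
  obtain ⟨ι, _, κ, θ, hκs, hκsum, hκθ⟩ := exists_lattice_partition d (r := δ / 3) (by positivity)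
  have hdec : (fun g : ℝ × SpinLattice d => f g.1 * if g.2 = 0 then 1 else 0) =
      fun g => ∑ a ∈ J ×ˢ (Finset.univ : Finset ι), F a.1 g.1 * κ a.2 g.2 := by
    funext g
    rw [← hsum, ← hκsum, Finset.sum_mul_sum, Finset.sum_product]
  rw [hdec, smear_sum hU hcyc A _ fun a _ => integrable_haar_mul (F a.1).integrable (hκs a.2)]
  refine Finset.sum_eq_zero fun a _ => ?_
  set Z : Set (Dual d) := {q | q.1 ∈ M ∧ dist q.1 (c a.1) ≤ δ / 3 ∧ dist q.2 (θ a.2) ≤ δ / 3} with hZ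
  have hZc : IsClosed Z := by
    refine (hM.isClosed.preimage continuous_fst).inter (IsClosed.inter ?_ ?_)
    · exact isClosed_le (continuous_fst.dist continuous_const) continuous_const
    · exact isClosed_le (continuous_snd.dist continuous_const) continuous_const
  have hts : tsupport (fourier fun g : ℝ × SpinLattice d => F a.1 g.1 * κ a.2 g.2) ⊆ Z := by
    refine closure_minimal (fun q hq => ?_) hZc
    rw [Function.mem_support, fourier_mul _ (hκs a.2)] at hq
    have h1 := right_ne_zero_of_mul hq
    obtain ⟨h2, h3⟩ := hFc a.1 q.1 (left_ne_zero_of_mul h1)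
    exact ⟨h2, h3, hκθ a.2 q.2 (right_ne_zero_of_mul h1)⟩
  have hint := integrable_haar_mul (F a.1).integrable (hκs a.2)
  rcases Z.eq_empty_or_nonempty with he | ⟨z, hz⟩
  · rw [he] at hts
    refine S₀.2.2 _ hint ?_
    rw [Set.subset_empty_iff.1 hts]
    exact Set.empty_disjoint _
  · obtain ⟨S, hS⟩ := hcov z ⟨hz.1, Set.mem_univ _⟩
    refine S.2.2 _ hint ?_
    rw [Set.disjoint_left]
    intro q hq hqS
    refine hS ?_ hqS
    have hq' := hts hq
    rw [Metric.mem_ball, Prod.dist_eq, max_lt_iff]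
    constructor
    · have := dist_triangle_right q.1 z.1 (c a.1)
      linarith [hq'.2.1, hz.2.1]
    · have := dist_triangle_right q.2 z.2 (θ a.2)
      linarith [hq'.2.2, hz.2.2]

/-- The integrated form of `smear_time_eq_zero` in the representation. -/
theorem integral_conj_eq_zero [Nontrivial H] (hU : IsImplementation Φ π Ω U)
    (hcyc : Dense (Set.range fun A => π A Ω)) {A : Observable d ℓ} {ε : ℝ} (hε : 0 < ε)
    (hA : arvesonSpectrum Φ A ⊆ Set.Iic (-ε) ×ˢ Set.univ) (f : 𝓢(ℝ, ℂ)) {M : Set ℝ}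
    (hM : IsCompact M) (hf : ∀ E, timeFourier f E ≠ 0 → E ∈ M) (hMε : M ⊆ Set.Ioi (-ε)) (ψ : H) :
    ∫ t, f t • (U (t, 0) : H →L[ℂ] H) (π A ((U (-t, 0) : H →L[ℂ] H) ψ)) = 0 := by
  have hκ : Summable fun x : SpinLattice d => ‖(if x = 0 then 1 else 0 : ℂ)‖ :=
    summable_of_ne_finset_zero (s := {0}) fun x hx => by
      rw [Finset.mem_singleton] at hx
      simp [hx]
  have hint := integrable_haar_mul f.integrable hκ
  have h0 := smear_time_eq_zero hU hcyc hε hA f hM hf hMε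
  have h1 := representation_smear_apply hU hcyc A hint ψ
  rw [h0, map_zero, zero_apply, integral_haar_single] at h1
  · have hc : ((2 * Real.pi) ^ (-((d : ℝ) + 1) / 2) : ℝ) ≠ 0 := by positivity
    have h2 := (smul_eq_zero.1 h1.symm).resolve_left hc
    rw [← h2]
    refine integral_congr_ae (Eventually.of_forall fun t => ?_)
    simp
  · refine hint.smul_bdd (‖π A‖ * ‖ψ‖) (Continuous.aestronglyMeasurable ?_)
      (Eventually.of_forall fun g => ?_)
    · exact hU.continuous_apply continuous_id
        ((π A).continuous.comp (hU.continuous_apply continuous_neg continuous_const))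
    · rw [norm_unitary_apply]
      exact (ContinuousLinearMap.le_opNorm _ _).trans (by rw [norm_unitary_apply])
  · intro g hg
    simp [hg]

end Arveson

/-! ### Scalar measures of a projection-valued measure. -/

section SpectralMeasureLemmas

variable {X : Type*} [MeasurableSpace X] {H : Type*} [NormedAddCommGroup H] [InnerProductSpace ℂ H]
  [CompleteSpace H]

theorem SpectralMeasure.inner_proj (P : SpectralMeasure X H) {S : Set X} (hS : MeasurableSet S)
    (ψ : H) : (⟪ψ, P.proj S ψ⟫_ℂ).re = ‖P.proj S ψ‖ ^ 2 := by
  have h := P.isStarProjection S hS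
  have h1 : P.proj S ψ = ContinuousLinearMap.adjoint (P.proj S) (P.proj S ψ) := by
    rw [← ContinuousLinearMap.star_eq_adjoint, h.isSelfAdjoint.star_eq, ← mul_apply_eq_comp,
      h.isIdempotentElem.eq]
  conv_lhs => rw [h1, ContinuousLinearMap.adjoint_inner_right]
  exact inner_self_eq_norm_sq (𝕜 := ℂ) _

theorem SpectralMeasure.scalarMeasure_apply (P : SpectralMeasure X H) {S : Set X}
    (hS : MeasurableSet S) (ψ : H) : P.scalarMeasure ψ S = ENNReal.ofReal (‖P.proj S ψ‖ ^ 2) := by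
  rw [SpectralMeasure.scalarMeasure, Measure.ofMeasurable_apply S hS, P.inner_proj hS]

theorem SpectralMeasure.scalarMeasure_eq_zero_iff (P : SpectralMeasure X H) {S : Set X}
    (hS : MeasurableSet S) (ψ : H) : P.scalarMeasure ψ S = 0 ↔ P.proj S ψ = 0 := by
  rw [P.scalarMeasure_apply hS, ENNReal.ofReal_eq_zero]
  constructor
  · intro h
    have := le_antisymm h (sq_nonneg _)
    simpa using this
  · intro h
    simp [h]

theorem SpectralMeasure.scalarMeasure_univ (P : SpectralMeasure X H) (ψ : H) :
    P.scalarMeasure ψ Set.univ = ENNReal.ofReal (‖ψ‖ ^ 2) := by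
  rw [P.scalarMeasure_apply MeasurableSet.univ, P.univ, one_apply_eq_self]

instance (P : SpectralMeasure X H) (ψ : H) : IsFiniteMeasure (P.scalarMeasure ψ) :=
  ⟨by rw [P.scalarMeasure_univ]; exact ENNReal.ofReal_lt_top⟩

theorem SpectralMeasure.ae_mem_of_proj_eq (P : SpectralMeasure X H) {S : Set X}
    (hS : MeasurableSet S) (ψ : H) : ∀ᵐ q ∂(P.scalarMeasure (P.proj S ψ)), q ∈ S := by
  change P.scalarMeasure (P.proj S ψ) Sᶜ = 0
  rw [P.scalarMeasure_eq_zero_iff hS.compl, ← mul_apply_eq_comp, ← P.inter _ _ hS.compl hS,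
    Set.compl_inter_self, P.proj_empty, zero_apply]

end SpectralMeasureLemmas

/-! ### Smearing in time as a functional calculus of the energy. -/

section Energy

open scoped SchwartzMap ContDiff

variable {d ℓ : ℕ} {H : Type*} [NormedAddCommGroup H] [InnerProductSpace ℂ H] [CompleteSpace H]
  {Φ : Interaction d ℓ} {π : Observable d ℓ →⋆ₐ[ℂ] (H →L[ℂ] H)} {Ω : H}
  {U : ℝ × SpinLattice d → unitary (H →L[ℂ] H)} {P : SpectralMeasure (Dual d) H}

/-- The smeared vector `∫ k(t) U(t) ψ dt`. -/
noncomputable def timeSmear (U : ℝ × SpinLattice d → unitary (H →L[ℂ] H)) (k : ℝ → ℂ) (ψ : H) : H :=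
  ∫ t, k t • (U (t, 0) : H →L[ℂ] H) ψ

theorem IsImplementation.continuous_time (hU : IsImplementation Φ π Ω U) (ψ : H) :
    Continuous fun t : ℝ => (U (t, 0) : H →L[ℂ] H) ψ :=
  hU.continuous_apply (by fun_prop) continuous_const

theorem integrable_timeSmear (hU : IsImplementation Φ π Ω U) (k : 𝓢(ℝ, ℂ)) (ψ : H) :
    Integrable fun t => k t • (U (t, 0) : H →L[ℂ] H) ψ :=
  k.integrable.smul_bdd ‖ψ‖ (hU.continuous_time ψ).aestronglyMeasurable
    (Eventually.of_forall fun _ => (norm_unitary_apply _ _).le)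

/-- Both vectors lie on the orbit of `ψ`, so the diagonal matrix elements suffice and no
polarisation is needed. -/
theorem inner_unitary (hU : IsImplementation Φ π Ω U) (hP : IsSpectralMeasureOf P U) (s t : ℝ)
    (ψ : H) : ⟪(U (s, 0) : H →L[ℂ] H) ψ, (U (t, 0) : H →L[ℂ] H) ψ⟫_ℂ =
      ∫ q, Complex.exp (Complex.I * (q.1 * (t - s) : ℝ)) ∂(P.scalarMeasure ψ) := by
  have h1 : (U (t, 0) : H →L[ℂ] H) ψ = (U (s, 0) : H →L[ℂ] H) ((U (t - s, 0) : H →L[ℂ] H) ψ) := by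
    rw [← hU.apply_add]
    simp
  rw [h1, ContinuousLinearMap.inner_map_map_of_mem_unitary (U (s, 0)).2, hP]
  refine integral_congr_ae (Eventually.of_forall fun q => ?_)
  simp [phase]

theorem inner_unitary_timeSmear (hU : IsImplementation Φ π Ω U) (hP : IsSpectralMeasureOf P U)
    (s : ℝ) (g : 𝓢(ℝ, ℂ)) (ψ : H) : ⟪(U (s, 0) : H →L[ℂ] H) ψ, timeSmear U g ψ⟫_ℂ =
      ∫ q, Complex.exp (Complex.I * (-(q.1 * s) : ℝ)) * timeFourier g q.1 ∂(P.scalarMeasure ψ) := by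
  rw [timeSmear, ← integral_inner (integrable_timeSmear hU g ψ)]
  simp only [inner_smul_right, inner_unitary hU hP]
  simp only [← integral_const_mul]
  rw [integral_integral_swap]
  · refine integral_congr_ae (Eventually.of_forall fun q => ?_)
    change (∫ t : ℝ, _) = _ * timeFourier g q.1
    rw [timeFourier, ← integral_const_mul]
    refine integral_congr_ae (Eventually.of_forall fun t => ?_)
    change g t * _ = _ * (_ * g t)
    rw [← mul_assoc, ← Complex.exp_add, mul_comm]
    congr 2
    push_cast
    ring
  · have hi : Integrable (fun p : ℝ × Dual d => g p.1 * (1 : ℂ)) (volume.prod (P.scalarMeasure ψ)) :=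
      g.integrable.mul_prod (integrable_const (1 : ℂ))
    refine hi.mono (Continuous.aestronglyMeasurable ?_) (Eventually.of_forall fun p => ?_)
    · have := g.continuous
      simp only [Function.uncurry_def]
      fun_prop
    · simp only [Function.uncurry_def]
      rw [norm_mul, norm_exp_I_mul, norm_mul, norm_one]

/-- The map taking the transform of `f` to `timeSmear U f ψ` preserves inner products from `L²` of
the scalar measure of `ψ` into `H`. All later statements about the energy content of vectors rest on
this. -/
theorem inner_timeSmear (hU : IsImplementation Φ π Ω U) (hP : IsSpectralMeasureOf P U)
    (f g : 𝓢(ℝ, ℂ)) (ψ : H) : ⟪timeSmear U f ψ, timeSmear U g ψ⟫_ℂ =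
      ∫ q, (starRingEnd ℂ) (timeFourier f q.1) * timeFourier g q.1 ∂(P.scalarMeasure ψ) := by
  have h1 : ⟪timeSmear U f ψ, timeSmear U g ψ⟫_ℂ = ∫ s, (starRingEnd ℂ) (f s) *
      ⟪(U (s, 0) : H →L[ℂ] H) ψ, timeSmear U g ψ⟫_ℂ := by
    rw [← inner_conj_symm]
    conv_lhs => rw [timeSmear.eq_def U f, ← integral_inner (integrable_timeSmear hU f ψ)]
    rw [← integral_conj]
    refine integral_congr_ae (Eventually.of_forall fun s => ?_)
    change (starRingEnd ℂ) _ = _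
    rw [inner_conj_symm, inner_smul_left]
  rw [h1]
  simp only [inner_unitary_timeSmear hU hP, ← integral_const_mul]
  rw [integral_integral_swap]
  · refine integral_congr_ae (Eventually.of_forall fun q => ?_)
    change (∫ s : ℝ, _) = (starRingEnd ℂ) (timeFourier f q.1) * timeFourier g q.1
    rw [timeFourier.eq_def f, ← integral_conj, ← integral_mul_const]
    refine integral_congr_ae (Eventually.of_forall fun s => ?_)
    change (starRingEnd ℂ) (f s) * (_ * _) = (starRingEnd ℂ) (_ * f s) * _
    rw [map_mul, ← Complex.exp_conj, map_mul, Complex.conj_I, Complex.conj_ofReal]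
    have : Complex.I * ((-(q.1 * s) : ℝ) : ℂ) = -Complex.I * ((q.1 * s : ℝ) : ℂ) := by
      push_cast
      ring
    rw [this]
    ring
  · have hi : Integrable (fun p : ℝ × Dual d => f p.1 * ((∫ t, ‖g t‖ : ℝ) : ℂ))
        (volume.prod (P.scalarMeasure ψ)) :=
      f.integrable.mul_prod (integrable_const _)
    refine hi.mono (Continuous.aestronglyMeasurable ?_) (Eventually.of_forall fun p => ?_)
    · have h1 := f.continuous
      have h2 := (timeFourier_continuous g).comp (continuous_fst.comp
        (continuous_snd : Continuous fun p : ℝ × Dual d => p.2))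
      have h3 : Continuous fun p : ℝ × Dual d => (starRingEnd ℂ) (f p.1) :=
        Complex.continuous_conj.comp (h1.comp continuous_fst)
      simp only [Function.uncurry_def]
      exact h3.mul (Continuous.mul (by fun_prop) h2)
    · simp only [Function.uncurry_def]
      rw [norm_mul, norm_mul, norm_mul, norm_exp_I_mul, one_mul, Complex.norm_real, RCLike.norm_conj,
        Real.norm_of_nonneg (integral_nonneg fun _ => norm_nonneg _)]
      gcongr
      exact norm_timeFourier_le _ _

theorem integrable_timeFourier_mul (f g : 𝓢(ℝ, ℂ)) (ψ : H) : Integrable (fun q : Dual d =>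
    (starRingEnd ℂ) (timeFourier f q.1) * timeFourier g q.1) (P.scalarMeasure ψ) := by
  refine Integrable.of_bound (C := (∫ t, ‖f t‖) * ∫ t, ‖g t‖) (Continuous.aestronglyMeasurable ?_)
    (Eventually.of_forall fun q => ?_)
  · exact (Complex.continuous_conj.comp ((timeFourier_continuous f).comp continuous_fst)).mul
      ((timeFourier_continuous g).comp continuous_fst)
  · rw [norm_mul, RCLike.norm_conj]
    exact mul_le_mul (norm_timeFourier_le _ _) (norm_timeFourier_le _ _) (norm_nonneg _)
      (integral_nonneg fun _ => norm_nonneg _)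

theorem timeSmear_eq_zero_iff (hU : IsImplementation Φ π Ω U) (hP : IsSpectralMeasureOf P U)
    (f : 𝓢(ℝ, ℂ)) (ψ : H) :
    timeSmear U f ψ = 0 ↔ ∀ᵐ q ∂(P.scalarMeasure ψ), timeFourier f q.1 = 0 := by
  have h := inner_timeSmear hU hP f f ψ
  constructor
  · intro h0
    have h1 : ∫ q : Dual d, ‖timeFourier f q.1‖ ^ 2 ∂(P.scalarMeasure ψ) = 0 := by
      rw [h0, inner_zero_left] at h
      simp only [Complex.conj_mul', ← Complex.ofReal_pow] at h
      rw [integral_complex_ofReal] at h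
      exact_mod_cast h.symm
    have h2 : Integrable (fun q : Dual d => ‖timeFourier f q.1‖ ^ 2) (P.scalarMeasure ψ) := by
      refine (integrable_timeFourier_mul (P := P) f f ψ).norm.congr (Eventually.of_forall fun q => ?_)
      simp [sq]
    rw [integral_eq_zero_iff_of_nonneg (fun q => by positivity) h2] at h1
    filter_upwards [h1] with q hq
    simpa using hq
  · intro h0
    rw [← inner_self_eq_zero (𝕜 := ℂ), h]
    rw [← integral_zero (Dual d) ℂ (μ := P.scalarMeasure ψ)]
    refine integral_congr_ae ?_
    filter_upwards [h0] with q hq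
    simp [hq]

/-- All four inner products in the expansion of `‖timeSmear U h ψ - ψ‖²` coincide. -/
theorem timeSmear_eq_self (hU : IsImplementation Φ π Ω U) (hP : IsSpectralMeasureOf P U)
    (h : 𝓢(ℝ, ℂ)) (ψ : H) (h1 : ∀ᵐ q ∂(P.scalarMeasure ψ), timeFourier h q.1 = 1) :
    timeSmear U h ψ = ψ := by
  have e0 : (U ((0 : ℝ), (0 : SpinLattice d)) : H →L[ℂ] H) ψ = ψ := by
    have : ((0 : ℝ), (0 : SpinLattice d)) = 0 := rfl
    rw [this, hU.map_zero]
    rfl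
  have a1 : ⟪ψ, timeSmear U h ψ⟫_ℂ = ⟪ψ, ψ⟫_ℂ := by
    have b1 := inner_unitary_timeSmear hU hP 0 h ψ
    have b2 := inner_unitary hU hP 0 0 ψ
    rw [e0] at b1 b2
    rw [b1, b2]
    refine integral_congr_ae ?_
    filter_upwards [h1] with q hq
    simp [hq]
  have a2 : ⟪timeSmear U h ψ, timeSmear U h ψ⟫_ℂ = ⟪ψ, ψ⟫_ℂ := by
    have b2 := inner_unitary hU hP 0 0 ψ
    rw [e0] at b2
    rw [b2, inner_timeSmear hU hP]
    refine integral_congr_ae ?_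
    filter_upwards [h1] with q hq
    simp [hq]
  have a3 : ⟪timeSmear U h ψ, ψ⟫_ℂ = ⟪ψ, ψ⟫_ℂ := by
    rw [← inner_conj_symm, a1, inner_conj_symm]
  rw [← sub_eq_zero, ← inner_self_eq_zero (𝕜 := ℂ), inner_sub_left, inner_sub_right, inner_sub_right,
    a1, a2, a3]
  ring

end Energy

/-! ### Absence of negative energies. -/

section PositiveEnergy

open scoped SchwartzMap ContDiff FourierTransform Convolution

variable {d ℓ : ℕ} {H : Type*} [NormedAddCommGroup H] [InnerProductSpace ℂ H] [CompleteSpace H]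
  {Φ : Interaction d ℓ} {π : Observable d ℓ →⋆ₐ[ℂ] (H →L[ℂ] H)} {Ω : H}
  {U : ℝ × SpinLattice d → unitary (H →L[ℂ] H)} {P : SpectralMeasure (Dual d) H}

/-- A smooth even bump function of width `r`. -/
noncomputable def evenBump {r : ℝ} (hr : 0 < r) : ContDiffBump (0 : ℝ) := ⟨r / 2, r, by positivity, by linarith⟩

/-- For `|E| r ≤ 1` the cosine is positive on the support of the bump, so the real part of the
transform is positive. Evenness is needed for the convolution in `hasDerivAt_timeSmear`. -/
theorem exists_schwartz_evenBump {r : ℝ} (hr : 0 < r) :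
    ∃ k : 𝓢(ℝ, ℂ), HasCompactSupport k ∧ (∀ t, k (-t) = k t) ∧ ∀ E, |E| * r ≤ 1 → timeFourier k E ≠ 0 := by
  let b := evenBump hr
  have hs : HasCompactSupport (fun t => (b t : ℂ)) :=
    b.hasCompactSupport.comp_left Complex.ofReal_zero
  refine ⟨hs.toSchwartzMap (Complex.ofRealCLM.contDiff.comp b.contDiff), hs,
    fun t => congrArg Complex.ofReal (b.neg t), fun E hE h => ?_⟩
  have h1 : (timeFourier (fun t => (b t : ℂ)) E).re = ∫ t, Real.cos (E * t) * b t := by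
    rw [timeFourier, ← Complex.reCLM_apply, ← ContinuousLinearMap.integral_comp_comm]
    · refine integral_congr_ae (Eventually.of_forall fun t => ?_)
      change (Complex.exp (Complex.I * (E * t : ℝ)) * (b t : ℂ)).re = _
      rw [mul_comm Complex.I, Complex.re_mul_ofReal, Complex.exp_ofReal_mul_I_re]
    · have := b.continuous
      refine Continuous.integrable_of_hasCompactSupport (by fun_prop) hs.mul_left
  have h2 : 0 < ∫ t, Real.cos (E * t) * b t := by
    have hnn : ∀ t, 0 ≤ Real.cos (E * t) * b t := by
      intro t
      by_cases ht : |t| < r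
      · refine mul_nonneg (Real.cos_nonneg_of_mem_Icc ?_) b.nonneg
        have : |E * t| ≤ 1 := by
          rw [abs_mul]
          exact (by gcongr : |E| * |t| ≤ |E| * r).trans hE
        rw [abs_le] at this
        constructor <;> linarith [Real.pi_gt_three]
      · have : b t = 0 := b.zero_of_le_dist (by rw [dist_zero_right]; exact not_lt.1 ht)
        rw [this, mul_zero]
    have hcont : Continuous fun t => Real.cos (E * t) * b t := by
      have := b.continuous
      fun_prop
    refine hcont.integral_pos_of_hasCompactSupport_nonneg_nonzero b.hasCompactSupport.mul_left hnn
      (x := 0) ?_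
    rw [b.one_of_mem_closedBall (Metric.mem_closedBall_self b.rIn_pos.le)]
    simp
  have h3 : timeFourier (fun t => (b t : ℂ)) E = 0 := h
  rw [h3] at h1
  simp at h1
  linarith

theorem timeFourier_deriv (k : 𝓢(ℝ, ℂ)) (E : ℝ) :
    timeFourier (SchwartzMap.derivCLM ℂ ℂ k) E = -(Complex.I * E) * timeFourier k E := by
  have h := Real.fourier_deriv k.integrable k.differentiable (SchwartzMap.derivCLM ℂ ℂ k).integrable
  rw [timeFourier_eq, timeFourier_eq]
  have h2 := congrFun h (-(E / (2 * Real.pi)))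
  change 𝓕 (deriv k) _ = _
  rw [h2, smul_eq_mul]
  congr 1
  have : (Real.pi : ℂ) ≠ 0 := by exact_mod_cast Real.pi_ne_zero
  push_cast
  field_simp

theorem timeSmear_neg_comp (U : ℝ × SpinLattice d → unitary (H →L[ℂ] H)) (k : ℝ → ℂ) (ψ : H) :
    timeSmear U (fun t => k (-t)) ψ = ∫ t, k t • (U (-t, 0) : H →L[ℂ] H) ψ := by
  rw [timeSmear, ← integral_neg_eq_self]
  simp

/-- By evenness `U(s)` applied to the smeared vector is the convolution of `k` with the orbit of
`ψ`, so the derivative falls on the smooth factor. Smeared vectors thus lie in the domain of the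
generator; the minus sign comes from the oddness of the derivative of `k`. -/
theorem hasDerivAt_timeSmear (hU : IsImplementation Φ π Ω U) (k : 𝓢(ℝ, ℂ))
    (hk : HasCompactSupport k) (heven : ∀ t, k (-t) = k t) (ψ : H) :
    HasDerivAt (fun s : ℝ => (U (s, 0) : H →L[ℂ] H) (timeSmear U k ψ))
      (-timeSmear U (SchwartzMap.derivCLM ℂ ℂ k) ψ) 0 := by
  have hcont := hU.continuous_time ψ
  have h := hk.hasDerivAt_convolution_left (μ := volume) (ContinuousLinearMap.lsmul ℝ ℂ)
    (k.smooth 1) hcont.locallyIntegrable 0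
  have e1 : (k ⋆[ContinuousLinearMap.lsmul ℝ ℂ, volume] fun t : ℝ => (U (t, 0) : H →L[ℂ] H) ψ) =
      fun s : ℝ => (U (s, 0) : H →L[ℂ] H) (timeSmear U k ψ) := by
    funext s
    have : timeSmear U k ψ = ∫ t, k t • (U (-t, 0) : H →L[ℂ] H) ψ := by
      rw [← timeSmear_neg_comp]
      congr 1
      funext t
      exact (heven t).symm
    rw [this, ← ContinuousLinearMap.integral_comp_comm]
    · rw [convolution_def]
      refine integral_congr_ae (Eventually.of_forall fun t => ?_)
      change k t • _ = (U (s, 0) : H →L[ℂ] H) (k t • _)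
      rw [map_smul, ← hU.apply_add]
      simp [sub_eq_add_neg]
    · exact k.integrable.smul_bdd ‖ψ‖ (hcont.comp continuous_neg).aestronglyMeasurable
        (Eventually.of_forall fun t => (norm_unitary_apply _ _).le)
  have e2 : (deriv k ⋆[ContinuousLinearMap.lsmul ℝ ℂ, volume]
      fun t : ℝ => (U (t, 0) : H →L[ℂ] H) ψ) 0 = -timeSmear U (SchwartzMap.derivCLM ℂ ℂ k) ψ := by
    have : ∀ t, deriv k (-t) = - deriv k t := fun t => by
      have h1 : (fun t => k (-t)) = k := funext heven
      have h2 := deriv_comp_neg (f := k) t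
      rw [h1] at h2
      rw [h2, neg_neg]
    rw [convolution_def, timeSmear, ← integral_neg, ← integral_neg_eq_self]
    refine integral_congr_ae (Eventually.of_forall fun t => ?_)
    change deriv k (-t) • (U (0 - -t, 0) : H →L[ℂ] H) ψ = -(deriv k t • (U (t, 0) : H →L[ℂ] H) ψ)
    rw [this, neg_smul, zero_sub, neg_neg]
  rw [e1, e2] at h
  exact h

/-- For `φ` of negative energies the expectation of the generator in the smeared vector is `∫ E
|k̂(E)|² dμ_φ`, which is both `≤ 0` and `≥ 0`. Hence `μ_φ` vanishes wherever `k̂ ≠ 0`, and narrower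
bumps `k` exhaust all energies. -/
theorem proj_negative_eq_zero (hU : IsImplementation Φ π Ω U) (hP : IsSpectralMeasureOf P U)
    (hpos : HasPositiveEnergy U) (ψ : H) : P.proj {q | q.1 < 0} ψ = 0 := by
  have hS : MeasurableSet {q : Dual d | q.1 < 0} := measurableSet_lt measurable_fst measurable_const
  set φ := P.proj {q | q.1 < 0} ψ with hφ
  have hneg : ∀ᵐ q ∂(P.scalarMeasure φ), q.1 < 0 := P.ae_mem_of_proj_eq hS ψ
  have hzero : ∀ n : ℕ, ∀ᵐ q ∂(P.scalarMeasure φ), ¬ |(q : Dual d).1| ≤ n + 1 := by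
    intro n
    -- At this width the transform of the bump has no zero in `|E| ≤ n + 1`.
    have hr : 0 < 1 / ((n : ℝ) + 1) := by positivity
    obtain ⟨k, hk, heven, hne⟩ := exists_schwartz_evenBump hr
    set k' := SchwartzMap.derivCLM ℂ ℂ k with hk'
    have hd := hasDerivAt_timeSmear hU k hk heven φ
    have h0 := hpos (timeSmear U k φ) (Complex.I • timeSmear U k' φ) (by
      rw [smul_smul, Complex.I_mul_I, neg_one_smul]
      exact hd)
    have hint := integrable_timeFourier_mul (P := P) k k' φ
    have e : ∀ q : Dual d, Complex.I * ((starRingEnd ℂ) (timeFourier k q.1) * timeFourier k' q.1) =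
        ((q.1 * ‖timeFourier k q.1‖ ^ 2 : ℝ) : ℂ) := fun q => by
      rw [hk', timeFourier_deriv]
      push_cast
      rw [← Complex.conj_mul']
      linear_combination (-(q.1 : ℂ) * (starRingEnd ℂ) (timeFourier k q.1) * timeFourier k q.1) *
        Complex.I_mul_I
    rw [inner_smul_right, inner_timeSmear hU hP, ← integral_const_mul] at h0
    simp only [e] at h0
    rw [integral_complex_ofReal, Complex.zero_le_real] at h0
    have hint2 : Integrable (fun q : Dual d => q.1 * ‖timeFourier k q.1‖ ^ 2) (P.scalarMeasure φ) := by
      refine ((hint.const_mul Complex.I).re).congr (Eventually.of_forall fun q => ?_)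
      change RCLike.re (Complex.I * _) = _
      rw [e]
      exact Complex.ofReal_re _
    have hle : ∀ᵐ q ∂(P.scalarMeasure φ), 0 ≤ -((q : Dual d).1 * ‖timeFourier k q.1‖ ^ 2) := by
      filter_upwards [hneg] with q hq
      nlinarith [sq_nonneg ‖timeFourier k q.1‖]
    have h1 : ∫ q : Dual d, -(q.1 * ‖timeFourier k q.1‖ ^ 2) ∂(P.scalarMeasure φ) = 0 := by
      refine le_antisymm ?_ (integral_nonneg_of_ae hle)
      rw [integral_neg]
      linarith
    rw [integral_eq_zero_iff_of_nonneg_ae hle hint2.neg] at h1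
    filter_upwards [h1, hneg] with q hq hq0 hq1
    have hz : q.1 * ‖timeFourier k q.1‖ ^ 2 = 0 := by
      have : -(q.1 * ‖timeFourier k q.1‖ ^ 2) = 0 := hq
      linarith
    rcases mul_eq_zero.1 hz with h | h
    · exact hq0.ne h
    · refine hne q.1 ?_ (by simpa using h)
      rw [mul_one_div, div_le_one (by positivity)]
      exact hq1
  rw [← ae_all_iff] at hzero
  have hF : ∀ᵐ q ∂(P.scalarMeasure φ), False := by
    filter_upwards [hzero] with q hq
    obtain ⟨n, hn⟩ := exists_nat_ge |q.1|
    exact hq n (by linarith)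
  rw [ae_iff] at hF
  simp only [not_false_eq_true, Set.ofPred_true] at hF
  rw [P.scalarMeasure_univ, ENNReal.ofReal_eq_zero] at hF
  have := le_antisymm hF (sq_nonneg _)
  simpa using this

end PositiveEnergy

/-! ### Energy transfer of observables with negative Arveson spectrum. -/

section EnergyTransfer

open scoped SchwartzMap ContDiff

variable {d ℓ : ℕ} {H : Type*} [NormedAddCommGroup H] [InnerProductSpace ℂ H] [CompleteSpace H]
  {Φ : Interaction d ℓ} {π : Observable d ℓ →⋆ₐ[ℂ] (H →L[ℂ] H)} {Ω : H}
  {U : ℝ × SpinLattice d → unitary (H →L[ℂ] H)} {P : SpectralMeasure (Dual d) H}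

/-- The energy content of `ψ` lies in `(-∞, a]`: the smearing of `ψ` with a function whose band is a
compact subset of `(a, ∞)` vanishes. -/
def EnergyLE (U : ℝ × SpinLattice d → unitary (H →L[ℂ] H)) (a : ℝ) (ψ : H) : Prop :=
  ∀ (k : 𝓢(ℝ, ℂ)) (M : Set ℝ), IsCompact M → M ⊆ Set.Ioi a →
    (∀ E, timeFourier k E ≠ 0 → E ∈ M) → timeSmear U k ψ = 0

theorem exists_band_function (a b : ℝ) :
    ∃ k : 𝓢(ℝ, ℂ), ∀ E, timeFourier k E ≠ 0 ↔ a < E ∧ E < b := by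
  let η : ℝ → ℝ := fun E => expNegInvGlue (E - a) * expNegInvGlue (b - E)
  have hη : ∀ E, η E ≠ 0 ↔ a < E ∧ E < b := fun E => by
    simp [η, mul_eq_zero, not_or]
  have hc : HasCompactSupport fun E => (η E : ℂ) := by
    refine HasCompactSupport.intro (isCompact_Icc (a := a) (b := b)) fun E hE => ?_
    by_contra h
    have := (hη E).1 (by exact_mod_cast h)
    exact hE ⟨this.1.le, this.2.le⟩
  have hs : ContDiff ℝ ∞ η :=
    (expNegInvGlue.contDiff.comp (by fun_prop)).mul (expNegInvGlue.contDiff.comp (by fun_prop))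
  obtain ⟨k, hk⟩ := exists_timeFourier_eq (Complex.ofRealCLM.contDiff.comp hs) hc
  refine ⟨k, fun E => ?_⟩
  rw [hk, ← hη]
  exact Complex.ofReal_ne_zero

/-- The lower edge `-1` is arbitrary, since the plateau only has to cover nonnegative energies. -/
theorem exists_plateau_function (a : ℝ) {δ : ℝ} (hδ : 0 < δ) :
    ∃ h : 𝓢(ℝ, ℂ), (∀ E, 0 ≤ E → E ≤ a → timeFourier h E = 1) ∧
      ∀ E, timeFourier h E ≠ 0 → E ∈ Set.Icc (-1) (a + δ) := by
  let η : ℝ → ℝ := fun E => Real.smoothTransition (E + 1) * Real.smoothTransition ((a + δ - E) / δ)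
  have hη : ∀ E, η E ≠ 0 → E ∈ Set.Icc (-1) (a + δ) := fun E h => by
    constructor
    · by_contra hE
      refine h ?_
      simp only [η]
      rw [Real.smoothTransition.zero_of_nonpos (by linarith), zero_mul]
    · by_contra hE
      refine h ?_
      simp only [η]
      rw [Real.smoothTransition.zero_of_nonpos (x := (a + δ - E) / δ)
        (div_nonpos_of_nonpos_of_nonneg (by linarith) hδ.le), mul_zero]
  have hc : HasCompactSupport fun E => (η E : ℂ) := by
    refine HasCompactSupport.intro (isCompact_Icc (a := -1) (b := a + δ)) fun E hE => ?_
    by_contra h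
    exact hE (hη E (by exact_mod_cast h))
  have hs : ContDiff ℝ ∞ η := (Real.smoothTransition.contDiff.comp (by fun_prop)).mul
    (Real.smoothTransition.contDiff.comp (by fun_prop))
  obtain ⟨k, hk⟩ := exists_timeFourier_eq (Complex.ofRealCLM.contDiff.comp hs) hc
  refine ⟨k, fun E h0 ha => ?_, fun E h => hη E ?_⟩
  · rw [hk]
    change ((η E : ℝ) : ℂ) = 1
    simp only [η]
    rw [Real.smoothTransition.one_of_one_le (by linarith), Real.smoothTransition.one_of_one_le
      (by rw [le_div_iff₀ hδ]; linarith)]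
    simp
  · rw [hk] at h
    exact Complex.ofReal_ne_zero.1 h

/-- The bands `(a + 1/(n+1), n)` exhaust `(a, ∞)`, so the test functions detect all weight above
`a`. -/
theorem energyLE_iff (hU : IsImplementation Φ π Ω U) (hP : IsSpectralMeasureOf P U) (a : ℝ) (ψ : H) :
    EnergyLE U a ψ ↔ ∀ᵐ q ∂(P.scalarMeasure ψ), (q : Dual d).1 ≤ a := by
  constructor
  · intro h
    have h1 : ∀ n : ℕ, ∀ᵐ q ∂(P.scalarMeasure ψ),
        ¬ (a + 1 / (n + 1) < (q : Dual d).1 ∧ q.1 < n) := by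
      intro n
      obtain ⟨k, hk⟩ := exists_band_function (a + 1 / (n + 1)) n
      have hn : 0 < 1 / ((n : ℝ) + 1) := by positivity
      have h2 := h k (Set.Icc (a + 1 / (n + 1)) n) isCompact_Icc
        (fun E hE => lt_of_lt_of_le (by linarith) hE.1)
        (fun E hE => ⟨((hk E).1 hE).1.le, ((hk E).1 hE).2.le⟩)
      rw [timeSmear_eq_zero_iff hU hP] at h2
      filter_upwards [h2] with q hq hq'
      exact (hk q.1).2 hq' hq
    rw [← ae_all_iff] at h1
    filter_upwards [h1] with q hq
    by_contra hlt
    push Not at hlt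
    obtain ⟨n, hn⟩ := exists_nat_gt (max q.1 (1 / (q.1 - a)))
    have hd : 0 < q.1 - a := sub_pos.2 hlt
    refine hq n ⟨?_, (le_max_left _ _).trans_lt hn⟩
    have h3 : 1 / (q.1 - a) < n + 1 := ((le_max_right _ _).trans_lt hn).trans (by linarith)
    have h4 : 1 / ((n : ℝ) + 1) < q.1 - a := by
      rw [div_lt_iff₀ hd] at h3
      rw [div_lt_iff₀ (by positivity)]
      linarith
    linarith
  · intro h k M _ hMa hk
    rw [timeSmear_eq_zero_iff hU hP]
    filter_upwards [h] with q hq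
    by_contra hne
    exact absurd (hMa (hk _ hne)) (not_lt.2 hq)

theorem ae_energy_nonneg (hU : IsImplementation Φ π Ω U) (hP : IsSpectralMeasureOf P U)
    (hpos : HasPositiveEnergy U) (ψ : H) : ∀ᵐ q ∂(P.scalarMeasure ψ), 0 ≤ (q : Dual d).1 := by
  have hS : MeasurableSet {q : Dual d | q.1 < 0} := measurableSet_lt measurable_fst measurable_const
  have h := (P.scalarMeasure_eq_zero_iff hS ψ).2 (proj_negative_eq_zero hU hP hpos ψ)
  have h2 : ∀ᵐ q ∂(P.scalarMeasure ψ), ¬ (q : Dual d).1 < 0 := by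
    rw [ae_iff]
    simpa using h
  filter_upwards [h2] with q hq
  exact not_lt.1 hq

theorem EnergyLE.eq_zero (hU : IsImplementation Φ π Ω U) (hP : IsSpectralMeasureOf P U)
    (hpos : HasPositiveEnergy U) {a : ℝ} (ha : a < 0) {ψ : H} (h : EnergyLE U a ψ) : ψ = 0 := by
  rw [energyLE_iff hU hP] at h
  have hF : ∀ᵐ q ∂(P.scalarMeasure ψ), False := by
    filter_upwards [h, ae_energy_nonneg hU hP hpos ψ] with q h1 h2
    linarith
  rw [ae_iff] at hF
  simp only [not_false_eq_true, Set.ofPred_true] at hF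
  rw [P.scalarMeasure_univ, ENNReal.ofReal_eq_zero] at hF
  have := le_antisymm hF (sq_nonneg _)
  simpa using this

/-- Positivity bounds the energies of `ψ` from below, so `ψ` is reproduced by a smearing of compact
band. -/
theorem EnergyLE.exists_timeSmear_eq (hU : IsImplementation Φ π Ω U) (hP : IsSpectralMeasureOf P U)
    (hpos : HasPositiveEnergy U) {a : ℝ} {ψ : H} (h : EnergyLE U a ψ) {δ : ℝ} (hδ : 0 < δ) :
    ∃ k : 𝓢(ℝ, ℂ), timeSmear U k ψ = ψ ∧
      ∀ E, timeFourier k E ≠ 0 → E ∈ Set.Icc (-1) (a + δ) := by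
  obtain ⟨k, h1, h2⟩ := exists_plateau_function a hδ
  refine ⟨k, timeSmear_eq_self hU hP k ψ ?_, h2⟩
  rw [energyLE_iff hU hP] at h
  filter_upwards [h, ae_energy_nonneg hU hP hpos ψ] with q h3 h4
  exact h1 _ h4 h3

/-- An observable whose Arveson spectrum lies in `E ≤ -ε` lowers the energy by `ε`. -/
theorem EnergyLE.representation_apply [Nontrivial H] (hU : IsImplementation Φ π Ω U)
    (hcyc : Dense (Set.range fun A => π A Ω)) (hP : IsSpectralMeasureOf P U)
    (hpos : HasPositiveEnergy U) {A : Observable d ℓ} {ε : ℝ} (hε : 0 < ε)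
    (hA : arvesonSpectrum Φ A ⊆ Set.Iic (-ε) ×ˢ Set.univ) {a : ℝ} {ψ : H} (h : EnergyLE U a ψ) :
    EnergyLE U (a - ε) (π A ψ) := by
  intro k M hM hMa hk
  -- Of the room `2δ`, one `δ` goes to the reproducing function of `ψ`; the other keeps the
  -- resulting band strictly above `-ε`.
  obtain ⟨δ, hδ, hMδ⟩ : ∃ δ > 0, ∀ E ∈ M, a - ε + 2 * δ ≤ E := by
    rcases M.eq_empty_or_nonempty with he | hne
    · exact ⟨1, one_pos, by simp [he]⟩
    · obtain ⟨b, hb, hbl⟩ := hM.exists_isLeast hne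
      have : a - ε < b := hMa hb
      exact ⟨(b - (a - ε)) / 2, by linarith, fun E hE => by linarith [hbl hE]⟩
  obtain ⟨h', hψ, hh⟩ := h.exists_timeSmear_eq hU hP hpos hδ
  -- For fixed `u` this is `A` smeared with `s ↦ k(s) h'(u - s)`, whose band lies in `M - [-1, a +
  -- δ]` and so above `-ε`, applied to `U(u) ψ`.
  have hinner : ∀ u : ℝ, ∫ s, (k s * h' (u - s)) •
      (U (s, 0) : H →L[ℂ] H) (π A ((U (-s, 0) : H →L[ℂ] H) ((U (u, 0) : H →L[ℂ] H) ψ))) = 0 := by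
    intro u
    obtain ⟨g, hg, hgE⟩ := exists_mul_reflect k h' u
    have hM' : IsCompact (M - Set.Icc (-1) (a + δ)) := by
      rw [← Set.sub_image_prod]
      exact (hM.prod isCompact_Icc).image (by fun_prop)
    have := integral_conj_eq_zero hU hcyc hε hA g hM' (fun E hE => ?_) ?_ ((U (u, 0) : H →L[ℂ] H) ψ)
    · simpa only [hg] using this
    · obtain ⟨E', h1, h2⟩ := hgE E hE
      exact Set.mem_sub.2 ⟨E + E', hk _ h2, E', hh _ h1, by ring⟩
    · rintro E hE
      obtain ⟨x, hx, y, hy, rfl⟩ := Set.mem_sub.1 hE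
      have := hMδ x hx
      have := hy.2
      change -ε < x - y
      linarith
  -- Reproducing `ψ` with the time variable shifted by `s` makes the final vector depend on `u`
  -- only; Fubini then reduces the claim to `hinner`.
  have hpush : ∀ s : ℝ, k s • (U (s, 0) : H →L[ℂ] H) (π A ψ) = ∫ u, (k s * h' (u - s)) •
      (U (s, 0) : H →L[ℂ] H) (π A ((U (-s, 0) : H →L[ℂ] H) ((U (u, 0) : H →L[ℂ] H) ψ))) := by
    intro s
    have e : ψ = ∫ u, h' (u - s) • (U (u - s, 0) : H →L[ℂ] H) ψ := by
      rw [integral_sub_right_eq_self (fun t => h' t • (U (t, 0) : H →L[ℂ] H) ψ) s]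
      exact hψ.symm
    have hi : Integrable fun u => h' (u - s) • (U (u - s, 0) : H →L[ℂ] H) ψ :=
      (integrable_timeSmear hU h' ψ).comp_sub_right s
    let L : H →L[ℂ] H := k s • ((U (s, 0) : H →L[ℂ] H) * π A)
    change L ψ = _
    conv_lhs => rw [e]
    rw [← L.integral_comp_comm hi]
    refine integral_congr_ae (Eventually.of_forall fun u => ?_)
    change k s • (U (s, 0) : H →L[ℂ] H) (π A (h' (u - s) • (U (u - s, 0) : H →L[ℂ] H) ψ)) =
      (k s * h' (u - s)) •
        (U (s, 0) : H →L[ℂ] H) (π A ((U (-s, 0) : H →L[ℂ] H) ((U (u, 0) : H →L[ℂ] H) ψ)))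
    rw [map_smul, map_smul, smul_smul, ← hU.apply_add]
    simp [sub_eq_add_neg, add_comm]
  rw [timeSmear]
  simp only [hpush]
  rw [integral_integral_swap]
  · simp only [hinner, integral_zero]
  · have hi : Integrable (fun p : ℝ × ℝ => k p.1 * h' (p.2 - p.1)) (volume.prod volume) :=
      (Integrable.convolution_integrand (ContinuousLinearMap.mul ℂ ℂ) k.integrable
        h'.integrable).swap
    refine hi.smul_bdd (‖π A‖ * ‖ψ‖) (Continuous.aestronglyMeasurable ?_)
      (Eventually.of_forall fun p => ?_)
    · exact hU.continuous_apply (by fun_prop) ((π A).continuous.comp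
        (hU.continuous_apply (by fun_prop) (hU.continuous_apply (by fun_prop) continuous_const)))
    · rw [norm_unitary_apply]
      refine (ContinuousLinearMap.le_opNorm _ _).trans ?_
      rw [norm_unitary_apply, norm_unitary_apply]

theorem EnergyLE.translate (hU : IsImplementation Φ π Ω U) {a : ℝ} {ψ : H} (h : EnergyLE U a ψ)
    (x : SpinLattice d) : EnergyLE U a ((U (0, x) : H →L[ℂ] H) ψ) := by
  intro k M hM hMa hk
  have h0 := h k M hM hMa hk
  rw [← map_zero (U (0, x) : H →L[ℂ] H), ← h0, timeSmear, timeSmear,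
    ← ContinuousLinearMap.integral_comp_comm _ (integrable_timeSmear hU k ψ)]
  refine integral_congr_ae (Eventually.of_forall fun t => ?_)
  change k t • (U (t, 0) : H →L[ℂ] H) ((U (0, x) : H →L[ℂ] H) ψ) =
    (U (0, x) : H →L[ℂ] H) (k t • (U (t, 0) : H →L[ℂ] H) ψ)
  rw [map_smul, ← hU.apply_add, ← hU.apply_add, add_comm]

theorem evolution_zero (Φ : Interaction d ℓ) (A : Observable d ℓ) : Φ.evolution 0 A = A := by
  have : ∀ Λ, Φ.localEvolution Λ 0 A = A := fun Λ => by
    simp [Interaction.localEvolution]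
  rw [Interaction.evolution]
  simp only [this]
  exact tendsto_const_nhds.limUnder_eq

theorem representation_translate (hU : IsImplementation Φ π Ω U) (A : Observable d ℓ)
    (x : SpinLattice d) (ψ : H) : π (latticeTranslate x A) ψ =
      (U (0, x) : H →L[ℂ] H) (π A ((U (0, -x) : H →L[ℂ] H) ψ)) := by
  have h := hU.implements (0, x) A
  rw [Interaction.spacetime, evolution_zero] at h
  rw [h, hU.star_eq]
  simp [mul_apply_eq_comp]

/-- Sufficiently long products of translates of an energy decreasing operator annihilate the vectors
of bounded energy. -/
theorem EnergyLE.annihilatedBy [Nontrivial H] (hU : IsImplementation Φ π Ω U)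
    (hcyc : Dense (Set.range fun A => π A Ω)) (hP : IsSpectralMeasureOf P U)
    (hpos : HasPositiveEnergy U) {A : Observable d ℓ} {ε : ℝ} (hε : 0 < ε)
    (hA : arvesonSpectrum Φ A ⊆ Set.Iic (-ε) ×ˢ Set.univ) (s : Finset (SpinLattice d)) {n : ℕ}
    {a : ℝ} (ha : a - n * ε < 0) {ψ : H} (h : EnergyLE U a ψ) :
    AnnihilatedBy s (fun x => π (latticeTranslate x A)) n ψ := by
  induction n generalizing a ψ with
  | zero => exact h.eq_zero hU hP hpos (by simpa using ha)
  | succ n ih =>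
    intro x _
    refine ih (a := a - ε) (by push_cast at ha; linarith) ?_
    change EnergyLE U (a - ε) (π (latticeTranslate x A) ψ)
    rw [representation_translate hU]
    exact (((h.translate hU (-x)).representation_apply hU hcyc hP hpos hε hA).translate hU x)

theorem energyLE_proj (hU : IsImplementation Φ π Ω U) (hP : IsSpectralMeasureOf P U)
    {Δ : Set (Dual d)} (hΔ : MeasurableSet Δ) {a : ℝ} (ha : ∀ q ∈ Δ, q.1 ≤ a) (ψ : H) :
    EnergyLE U a (P.proj Δ ψ) := by
  rw [energyLE_iff hU hP]
  filter_upwards [P.ae_mem_of_proj_eq hΔ ψ] with q hq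
  exact ha q hq

end EnergyTransfer

/-! ### Commutator sums and the uniform energy bound. -/

section Bounds

variable {d ℓ : ℕ} {H : Type*} [NormedAddCommGroup H] [InnerProductSpace ℂ H] [CompleteSpace H]

/-- The norm of the commutator `[A^*, τ_x(A)]`. -/
noncomputable def commutatorNorm (A : Observable d ℓ) (x : SpinLattice d) : ℝ :=
  ‖star A * latticeTranslate x A - latticeTranslate x A * star A‖

/-- Translating back by `y`, an isometric automorphism, leaves only the difference `x - y`. -/
theorem norm_commutator_representation_le (π : Observable d ℓ →⋆ₐ[ℂ] (H →L[ℂ] H))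
    (A : Observable d ℓ) (x y : SpinLattice d) :
    ‖π (latticeTranslate x A) * star (π (latticeTranslate y A)) -
      star (π (latticeTranslate y A)) * π (latticeTranslate x A)‖ ≤ commutatorNorm A (x - y) := by
  have e : translateHom ℓ y (latticeTranslate (x - y) A * star A - star A * latticeTranslate (x - y) A) =
      latticeTranslate x A * star (latticeTranslate y A) -
        star (latticeTranslate y A) * latticeTranslate x A := by
    rw [map_sub, map_mul, map_mul, map_star, translateHom_apply, translateHom_apply,
      latticeTranslate_latticeTranslate, add_sub_cancel]
  rw [← map_star, ← map_mul, ← map_mul, ← map_sub, ← e]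
  refine (norm_representation_le π _).trans ?_
  rw [translateHom_apply, norm_latticeTranslate, commutatorNorm, norm_sub_rev]

theorem representation_translate_star_mul_self (π : Observable d ℓ →⋆ₐ[ℂ] (H →L[ℂ] H))
    (A : Observable d ℓ) (x : SpinLattice d) : π (latticeTranslate x (star A * A)) =
      star (π (latticeTranslate x A)) * π (latticeTranslate x A) := by
  rw [← translateHom_apply, map_mul, map_mul, map_star, map_star, translateHom_apply]

theorem SpectralMeasure.norm_proj_apply_le {X : Type*} [MeasurableSpace X] (P : SpectralMeasure X H)
    {S : Set X} (hS : MeasurableSet S) (ψ : H) : ‖P.proj S ψ‖ ≤ ‖ψ‖ := by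
  have h := P.inner_proj hS ψ
  have h1 := (Complex.re_le_norm _).trans (norm_inner_le_norm (𝕜 := ℂ) ψ (P.proj S ψ))
  rw [h] at h1
  rcases (norm_nonneg (P.proj S ψ)).eq_or_lt with h0 | h0
  · rw [← h0]
    exact norm_nonneg _
  · exact le_of_mul_le_mul_right (by rwa [← sq]) h0

theorem sum_sub_le_sum_image {Λ T : Finset (SpinLattice d)} {c : SpinLattice d → ℝ}
    (hc : ∀ x, 0 ≤ c x) {f : SpinLattice d → SpinLattice d} (hf : Function.Injective f)
    (h : ∀ y ∈ Λ, f y ∈ T) : ∑ y ∈ Λ, c (f y) ≤ ∑ z ∈ T, c z := by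
  rw [← Finset.sum_image (f := c) hf.injOn]
  exact Finset.sum_le_sum_of_subset_of_nonneg (Finset.image_subset_iff.2 h) fun z _ _ => hc z

/-- The bound on the vectors of bounded energy, in terms of any bound on the commutator sums. -/
theorem exists_energy_bound [Nontrivial H] {Φ : Interaction d ℓ}
    {π : Observable d ℓ →⋆ₐ[ℂ] (H →L[ℂ] H)} {Ω : H} {U : ℝ × SpinLattice d → unitary (H →L[ℂ] H)}
    {P : SpectralMeasure (Dual d) H} (hU : IsImplementation Φ π Ω U)
    (hcyc : Dense (Set.range fun A => π A Ω)) (hP : IsSpectralMeasureOf P U)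
    (hpos : HasPositiveEnergy U) {Δ : Set (Dual d)} (hΔ : IsCompact Δ) {A : Observable d ℓ}
    (hA : IsCompact (arvesonSpectrum Φ A))
    (hAneg : arvesonSpectrum Φ A ⊆ Set.Iio 0 ×ˢ Set.univ) :
    ∃ n : ℕ, ∀ (Λ : Finset (SpinLattice d)) (D : ℝ), 0 ≤ D →
      (∀ x ∈ Λ, ∑ y ∈ Λ, commutatorNorm A (x - y) ≤ D) →
      (∀ y ∈ Λ, ∑ x ∈ Λ, commutatorNorm A (x - y) ≤ D) → ∀ ψ : H,
      ‖(∑ x ∈ Λ, star (π (latticeTranslate x A)) * π (latticeTranslate x A)) (P.proj Δ ψ)‖ ≤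
        n * D * ‖P.proj Δ ψ‖ := by
  -- Compactness turns negativity into a uniform gap: `-ε` is the largest energy in the spectrum of
  -- `A`.
  obtain ⟨ε, hε, hAε⟩ : ∃ ε > 0, arvesonSpectrum Φ A ⊆ Set.Iic (-ε) ×ˢ Set.univ := by
    rcases (arvesonSpectrum Φ A).eq_empty_or_nonempty with he | hne
    · exact ⟨1, one_pos, by simp [he]⟩
    · obtain ⟨q, hq, hmax⟩ := hA.exists_isMaxOn hne continuous_fst.continuousOn
      exact ⟨-q.1, neg_pos.2 (hAneg hq).1, fun z hz => ⟨by simpa using hmax hz, trivial⟩⟩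
  obtain ⟨a, ha⟩ := (hΔ.image continuous_fst).bddAbove
  -- After `n` steps of size `ε` the energy bound `a` is negative. This `n` depends on `Δ` and `A`
  -- only.
  obtain ⟨n, hn⟩ := exists_nat_gt (a / ε)
  rw [div_lt_iff₀ hε] at hn
  refine ⟨n, fun Λ D hD hrow hcol ψ => ?_⟩
  have hE : EnergyLE U a (P.proj Δ ψ) :=
    energyLE_proj hU hP hΔ.measurableSet (fun q hq => ha (Set.mem_image_of_mem _ hq)) ψ
  exact (hE.annihilatedBy hU hcyc hP hpos hε hAε Λ (n := n) (by linarith)).norm_sum_le hD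
    (fun x _ y _ => norm_commutator_representation_le π A x y) hrow hcol

end Bounds

end SpinSystem

/-! ### The theorem. -/

theorem theorem3p6 {d ℓ : ℕ}
    -- the metric `|x - y| = N (x - y)` on the lattice, equivalent to the Euclidean one
    (N : AddGroupNorm (SpinLattice d)) (hN : ∃ c : ℝ, 0 < c ∧ ∀ x : SpinLattice d, c * ‖x‖ ≤ N x)
    -- a translation invariant interaction in the class `B_λ`
    (F : ℝ → ℝ) (hF : IsDecayFunction N F) (lam : ℝ) (hlam : 0 < lam)
    (Φ : Interaction d ℓ) (hΦ : Φ.IsTranslationInvariant) (hnorm : Φ.decayNorm N F lam < ⊤)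
    -- a translation invariant ground state and its GNS representation
    (ω : Observable d ℓ →ₗ[ℂ] ℂ) (hω : IsInvariantState Φ ω)
    {H : Type*} [NormedAddCommGroup H] [InnerProductSpace ℂ H] [CompleteSpace H]
    (π : Observable d ℓ →⋆ₐ[ℂ] (H →L[ℂ] H)) (Ω : H) (hπ : IsGNS ω π Ω)
    (U : ℝ × SpinLattice d → unitary (H →L[ℂ] H)) (hU : IsImplementation Φ π Ω U)
    (hpos : HasPositiveEnergy U)
    -- the spectral measure of `U`
    (P : SpectralMeasure (Dual d) H) (hP : IsSpectralMeasureOf P U)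
    (Δ : Set (Dual d)) (hΔ : IsCompact Δ) (hΔU : Δ ⊆ P.support)
    (A : Observable d ℓ) (hA : IsCompact (arvesonSpectrum Φ A))
    (hAneg : arvesonSpectrum Φ A ⊆ Set.Iio 0 ×ˢ Set.univ) :
    (∃ C : ℝ, ∀ Λ : Finset (SpinLattice d),
      ‖P.proj Δ * (∑ x ∈ Λ, π (latticeTranslate x (star A * A))) * P.proj Δ‖ ≤
        C * ∑ x ∈ Λ - Λ, ‖star A * latticeTranslate x A - latticeTranslate x A * star A‖) ∧
    (IsAlmostLocal N A →
      ∃ T : H →L[ℂ] H, ∀ ψ : H,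
        HasSum (fun x : SpinLattice d => (P.proj Δ * π (latticeTranslate x (star A * A)) * P.proj Δ) ψ)
          (T ψ)) := by
  -- Normalisation of the state gives `Ω ≠ 0`.
  have hnt : Nontrivial H := by
    refine nontrivial_of_ne Ω 0 fun h => ?_
    have h1 := hπ.inner_eq 1
    rw [hω.map_one, h, inner_zero_left] at h1
    exact zero_ne_one h1
  have hc0 : ∀ x, 0 ≤ commutatorNorm A x := fun x => norm_nonneg _
  have hΔm : MeasurableSet Δ := hΔ.measurableSet
  obtain ⟨n, hn⟩ := exists_energy_bound hU hπ.cyclic hP hpos hΔ hA hAneg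
  constructor
  · refine ⟨n, fun Λ => ?_⟩
    change _ ≤ n * ∑ x ∈ Λ - Λ, commutatorNorm A x
    have hD0 : 0 ≤ ∑ x ∈ Λ - Λ, commutatorNorm A x := Finset.sum_nonneg fun x _ => hc0 x
    refine ContinuousLinearMap.opNorm_le_bound _ (by positivity) fun ψ => ?_
    simp only [representation_translate_star_mul_self, mul_apply_eq_comp]
    refine (P.norm_proj_apply_le hΔm _).trans ((hn Λ _ hD0 (fun x hx => ?_) (fun y hy => ?_) ψ).trans ?_)
    · exact sum_sub_le_sum_image hc0 sub_right_injective fun y hy => Finset.sub_mem_sub hx hy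
    · exact sum_sub_le_sum_image hc0 sub_left_injective fun x hx => Finset.sub_mem_sub hx hy
    · gcongr
      exact P.norm_proj_apply_le hΔm ψ
  · intro hloc
    obtain ⟨c, hc, hNc⟩ := hN
    have hs : Summable (commutatorNorm A) := summable_commutator hc hNc hloc
    have hD0 : 0 ≤ ∑' x, commutatorNorm A x := tsum_nonneg hc0
    -- With the projection absorbed into the factors the summands have the form `C_x^* C_x`; the
    -- commutator sum over the whole lattice serves as a `D` common to all finite regions.
    obtain ⟨T, hT⟩ := exists_hasSum_star_mul_self (fun x => π (latticeTranslate x A) * P.proj Δ)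
      (n * ∑' x, commutatorNorm A x) (fun s ψ => by
        have h1 := sum_norm_sq_le_inner s (fun x => π (latticeTranslate x A)) (P.proj Δ ψ)
        have h2 := hn s _ hD0
          (fun x _ => (sum_sub_le_sum_image hc0 sub_right_injective fun y hy =>
            Finset.mem_image_of_mem (fun y => x - y) hy).trans (hs.sum_le_tsum _ fun z _ => hc0 z))
          (fun y _ => (sum_sub_le_sum_image hc0 sub_left_injective fun x hx =>
            Finset.mem_image_of_mem (fun x => x - y) hx).trans (hs.sum_le_tsum _ fun z _ => hc0 z)) ψ
        have h3 := P.norm_proj_apply_le hΔm ψ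
        calc _ ≤ _ := h1
          _ ≤ ‖P.proj Δ ψ‖ * (n * (∑' x, commutatorNorm A x) * ‖P.proj Δ ψ‖) := by gcongr
          _ ≤ ‖ψ‖ * (n * (∑' x, commutatorNorm A x) * ‖ψ‖) := by gcongr
          _ = _ := by ring)
    refine ⟨T, fun ψ => ?_⟩
    convert! hT ψ using 2 with x
    rw [representation_translate_star_mul_self, star_mul,
      (P.isStarProjection Δ hΔm).isSelfAdjoint.star_eq]
    simp only [mul_assoc]
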